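/- **Theorem 3.1.** Let $n\in\mathbb Z$ with $|n|\ge 1$, and let $\alpha>0$, $R>0$, $Q_0>0$. For a real function $u$ on $[0,R]$ put $$\mathcal E(u)=\tfrac12\int_0^R\Big\{ru_r^2+\tfrac1r u^2+r\ln(1+\alpha u^2)\Big\}dr,\qquad Q(u)=2\pi\int_0^R ru^2\,dr,$$ $$\mathcal I(u)=\tfrac12\int_0^R\Big\{ru_r^2+\tfrac{n^2}{r}u^2-2\alpha^{-1}ru^2+2\alpha^{-2}r\ln(1+\alpha u^2)\Big\}dr,$$ and let $\mathcal A$ be the set of absolutely continuous $u$ on $[0,R]$ with $u(0)=u(R)=0$ and $\mathcal E(u)<\infty$. For $\kappa\in\mathbb R$, the $n$-vortex equation is $$(ru_r)_r-\frac{n^2}{r}u+\frac{2ru^3}{1+\alpha u^2}-2\kappa ru=0\ \text{ on }(0,R),\qquad u(0)=u(R)=0;$$ a solution is a function in $C[0,R]\cap C^2(0,R)$ that satisfies it. (i) There is a pair $(u,\kappa)$ such that $u$ minimises $\mathcal I$ over $\{v\in\mathcal A: Q(v)=Q_0\}$ (in particular $u\in\mathcal A$ and $Q(u)=Q_0$),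 $\kappa$ is the Lagrange multiplier in the sense that the first variation of $\mathcal I+\frac{\kappa}{2\pi}Q$ at $u$ vanishes in every direction $v\in\mathcal A$, $u$ is a solution of the $n$-vortex equation with this $\kappa$, and $u(r)>0$ for all $r\in(0,R)$. (ii) If $\kappa\in\mathbb R$ satisfies $n^2+2r^2\kappa>0$ for all $r\in[0,R]$, and $Q_0\le\frac14$, then the $n$-vortex equation with this $\kappa$ has no nontrivial solution $u$ with $\mathcal E(u)<\infty$ and $Q(u)=Q_0$. -/

import Mathlib

open Set MeasureTheory
open scoped ENNReal

namespace VortexSoliton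

noncomputable section

/-- The energy `½ ∫₀ᴿ { r u_r² + u²/r + r ln(1 + α u²) } dr`, as an extended nonnegative number
(for `α > 0` the integrand is nonnegative on `(0, R)`). -/
def energy (α R : ℝ) (u : ℝ → ℝ) : ℝ≥0∞ :=
  ∫⁻ r in Ioo 0 R, ENNReal.ofReal
    ((1 / 2) * (r * (deriv u r) ^ 2 + (u r) ^ 2 / r + r * Real.log (1 + α * (u r) ^ 2)))

/-- The action
`I(u) = ½ ∫₀ᴿ { r u_r² + n²/r u² - 2 α⁻¹ r u² + 2 α⁻² r ln(1 + α u²) } dr`.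
All its terms are integrable when `u` has finite energy. -/
def action (n : ℤ) (α R : ℝ) (u : ℝ → ℝ) : ℝ :=
  (1 / 2) * ∫ r in Ioo 0 R,
    (r * (deriv u r) ^ 2 + (n : ℝ) ^ 2 / r * (u r) ^ 2 - 2 * α⁻¹ * r * (u r) ^ 2
      + 2 * (α⁻¹) ^ 2 * r * Real.log (1 + α * (u r) ^ 2))

/-- The energy flux `Q(u) = 2π ∫₀ᴿ r u² dr`. -/
def flux (R : ℝ) (u : ℝ → ℝ) : ℝ :=
  2 * Real.pi * ∫ r in Ioo 0 R, r * (u r) ^ 2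

/-- The admissible class: absolutely continuous functions on `[0, R]` which vanish at both
endpoints and have finite energy. Values outside `[0, R]` play no role. -/
def admissible (α R : ℝ) : Set (ℝ → ℝ) :=
  {u | AbsolutelyContinuousOnInterval u 0 R ∧ u 0 = 0 ∧ u R = 0 ∧ energy α R u < ⊤}

/-- `u` minimises the action over the admissible functions with energy flux `Q₀`. -/
def IsConstrainedMinimizer (n : ℤ) (α R Q₀ : ℝ) (u : ℝ → ℝ) : Prop :=
  u ∈ admissible α R ∧ flux R u = Q₀ ∧
    ∀ v ∈ admissible α R, flux R v = Q₀ → action n α R u ≤ action n α R v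

/-- `κ` is the Lagrange multiplier of the constraint at `u`: the first variation of
`I + (κ / 2π) Q` at `u` vanishes in every admissible direction. -/
def IsLagrangeMultiplier (n : ℤ) (α R κ : ℝ) (u : ℝ → ℝ) : Prop :=
  ∀ v ∈ admissible α R,
    HasDerivAt (fun t : ℝ => action n α R (fun r => u r + t * v r)
      + κ / (2 * Real.pi) * flux R (fun r => u r + t * v r)) 0 0

/-- `u` is a classical solution of the `n`-vortex equation
`(r u_r)_r - (n²/r) u + 2 r u³ / (1 + α u²) - 2 κ r u = 0` on `(0, R)`, `u(0) = u(R) = 0`. -/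
structure IsVortexSolution (n : ℤ) (α R κ : ℝ) (u : ℝ → ℝ) : Prop where
  continuousOn : ContinuousOn u (Icc 0 R)
  contDiffOn : ContDiffOn ℝ 2 u (Ioo 0 R)
  equation : ∀ r ∈ Ioo 0 R,
    deriv (fun s => s * deriv u s) r - (n : ℝ) ^ 2 / r * u r
      + 2 * r * (u r) ^ 3 / (1 + α * (u r) ^ 2) - 2 * κ * r * u r = 0
  left_boundary : u 0 = 0
  right_boundary : u R = 0

end

end VortexSoliton

namespace VortexSoliton

open Filter Topology

noncomputable section

/-! ### Auxiliary measure theory -/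

/-! Existence. Under the constraint `Q = Q₀` the term `-2α⁻¹ r u²` of the action integrates to a
constant, so it suffices to minimise the nonnegative functional J = `reducedAction`. The direct
method runs in the larger class `FiniteEnergy`, which prescribes nothing at r = 0. A bound on ∫ r
u'² bounds r u² and gives equicontinuity away from 0, hence a subsequence converging pointwise,
along which mass and logarithmic term converge by domination. Since J(cu) ≤ c² J(u) for c² ≥ 1,
midpoints of the minimising sequence are almost minimal, and the parallelogram identity makes the
derivatives Cauchy in L²(r dr). Strong convergence thus replaces weak lower semicontinuity
(`exists_isReducedMinimizer`).

Scaling down does not raise J, so the minimiser u is also optimal among functions of larger mass.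
Directions orthogonal to u never lower the mass, so the first variation vanishes on them; projecting
an arbitrary direction produces a multiplier μ, and κ = μ/2 + α⁻¹. The du Bois-Reymond lemma makes u
a classical solution. Taking |u| for u, ODE uniqueness excludes interior zeros
(`eq_zero_of_touching`). Near 0 the term n²/r dominates, so r u' is monotone, and finiteness of ∫
u²/r forces u to rise from 0; this gives absolute continuity on [0, R] and returns u to the
admissible class (`absolutelyContinuousOnInterval_zero`).

Nonexistence. Testing the equation with u gives A ≤ 2 ∫ r u⁴ for A = ∫ r u'², up to truncation. The
radial Ladyzhenskaya inequality gives ∫ r u⁴ ≤ 4MA with M = Q/2π ≤ 1/(8π). Hence A ≤ 8MA ≤ A/3, so A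
= 0 and u vanishes. -/

theorem _root_.AbsolutelyContinuousOnInterval.congr {f g : ℝ → ℝ} {a b : ℝ}
    (hf : AbsolutelyContinuousOnInterval f a b) (h : EqOn f g (uIcc a b)) :
    AbsolutelyContinuousOnInterval g a b := by
  rw [absolutelyContinuousOnInterval_iff] at hf ⊢
  intro ε hε
  obtain ⟨δ, hδ, H⟩ := hf ε hε
  refine ⟨δ, hδ, fun E hE hlt => ?_⟩
  refine lt_of_le_of_lt (le_of_eq (Finset.sum_congr rfl fun i hi => ?_)) (H E hE hlt)
  rw [h (hE.1 i hi).1, h (hE.1 i hi).2]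

theorem _root_.AbsolutelyContinuousOnInterval.fun_abs {f : ℝ → ℝ} {a b : ℝ}
    (hf : AbsolutelyContinuousOnInterval f a b) :
    AbsolutelyContinuousOnInterval (fun x => |f x|) a b := by
  rw [absolutelyContinuousOnInterval_iff] at hf ⊢
  intro ε hε
  obtain ⟨δ, hδ, H⟩ := hf ε hε
  refine ⟨δ, hδ, fun E hE hlt => lt_of_le_of_lt (Finset.sum_le_sum fun i _ => ?_) (H E hE hlt)⟩
  simpa [Real.dist_eq] using abs_abs_sub_abs_le (f (E.2 i).1) (f (E.2 i).2)

/-- A continuous function with integrable classical derivative is absolutely continuous. -/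
theorem absolutelyContinuousOnInterval_of_deriv {u : ℝ → ℝ} {a b : ℝ} (hab : a ≤ b)
    (hc : ContinuousOn u (Icc a b)) (hd : ∀ x ∈ Ioo a b, DifferentiableAt ℝ u x)
    (hi : IntervalIntegrable (deriv u) volume a b) : AbsolutelyContinuousOnInterval u a b := by
  have h1 := (hi.absolutelyContinuousOnInterval_intervalIntegral (c := a) (by simp)).add
    ((LipschitzWith.const (u a)).lipschitzOnWith (s := uIcc a b)).absolutelyContinuousOnInterval
  refine h1.congr fun x hx => ?_
  rw [uIcc_of_le hab] at hx
  have h2 := intervalIntegral.integral_eq_sub_of_hasDerivAt_of_le hx.1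
    (hc.mono (Icc_subset_Icc_right hx.2))
    (fun y hy => (hd y ⟨hy.1, hy.2.trans_le hx.2⟩).hasDerivAt)
    (hi.mono_set (by rw [uIcc_of_le hx.1, uIcc_of_le hab]; exact Icc_subset_Icc_right hx.2))
  simp only [Pi.add_apply]
  rw [h2]; ring

/-! ### Cauchy–Schwarz for weighted integrals -/

section CauchySchwarz

variable {X : Type*} [MeasurableSpace X] {μ : Measure X} {w f g : X → ℝ}

theorem integral_linear_combination {F G H : X → ℝ} (hF : Integrable F μ) (hG : Integrable G μ)
    (hH : Integrable H μ) (a b c : ℝ) :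
    ∫ x, a * F x + b * G x + c * H x ∂μ = a * ∫ x, F x ∂μ + b * ∫ x, G x ∂μ + c * ∫ x, H x ∂μ := by
  have h1 : Integrable (fun x => a * F x + b * G x) μ := (hF.const_mul a).add (hG.const_mul b)
  rw [integral_add h1 (hH.const_mul c), integral_add (hF.const_mul a) (hG.const_mul b)]
  simp only [integral_const_mul]

theorem integrable_weight_mul (hw : ∀ᵐ x ∂μ, 0 ≤ w x) (hwm : AEStronglyMeasurable w μ)
    (hfm : AEStronglyMeasurable f μ) (hgm : AEStronglyMeasurable g μ)
    (hf : Integrable (fun x => w x * f x ^ 2) μ) (hg : Integrable (fun x => w x * g x ^ 2) μ) :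
    Integrable (fun x => w x * (f x * g x)) μ := by
  refine (hf.add hg).mono' (hwm.mul (hfm.mul hgm)) ?_
  filter_upwards [hw] with x hx
  rw [Real.norm_eq_abs, abs_mul, abs_of_nonneg hx, Pi.add_apply, ← mul_add]
  refine mul_le_mul_of_nonneg_left ?_ hx
  rw [abs_le]
  constructor <;> nlinarith [sq_nonneg (f x + g x), sq_nonneg (f x - g x)]

theorem sq_integral_weight_mul_le (hw : ∀ᵐ x ∂μ, 0 ≤ w x) (hwm : AEStronglyMeasurable w μ)
    (hfm : AEStronglyMeasurable f μ) (hgm : AEStronglyMeasurable g μ)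
    (hf : Integrable (fun x => w x * f x ^ 2) μ) (hg : Integrable (fun x => w x * g x ^ 2) μ) :
    (∫ x, w x * (f x * g x) ∂μ) ^ 2 ≤ (∫ x, w x * f x ^ 2 ∂μ) * ∫ x, w x * g x ^ 2 ∂μ := by
  have hfg := integrable_weight_mul hw hwm hfm hgm hf hg
  -- The quadratic polynomial t ↦ ∫ w (t f + g)² is nonnegative, so its discriminant is nonpositive.
  have key : ∀ t : ℝ, 0 ≤ (∫ x, w x * f x ^ 2 ∂μ) * (t * t)
      + (2 * ∫ x, w x * (f x * g x) ∂μ) * t + ∫ x, w x * g x ^ 2 ∂μ := by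
    intro t
    have h0 : 0 ≤ ∫ x, w x * (t * f x + g x) ^ 2 ∂μ :=
      integral_nonneg_of_ae (by filter_upwards [hw] with x hx; positivity)
    have h1 : ∫ x, w x * (t * f x + g x) ^ 2 ∂μ
        = ∫ x, (t * t) * (w x * f x ^ 2) + (2 * t) * (w x * (f x * g x))
          + 1 * (w x * g x ^ 2) ∂μ := by
      congr 1; ext x; ring
    rw [h1, integral_linear_combination hf hfg hg] at h0
    linarith
  have := discrim_le_zero key
  rw [discrim] at this
  nlinarith

end CauchySchwarz

/-- Away from the origin the weight is at least a, so |f| ≤ 1 + a⁻¹ r f². -/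
theorem intervalIntegrable_of_weighted {R : ℝ} {f : ℝ → ℝ} (hf : AEStronglyMeasurable f (volume.restrict (Ioo 0 R)))
    (h : IntegrableOn (fun r => r * f r ^ 2) (Ioo 0 R)) {a b : ℝ} (ha : 0 < a) (hab : a ≤ b)
    (hb : b ≤ R) : IntervalIntegrable f volume a b := by
  rw [intervalIntegrable_iff_integrableOn_Ioo_of_le hab]
  have h1 : IntegrableOn (fun r => r * f r ^ 2) (Ioo a b) := h.mono_set (Ioo_subset_Ioo ha.le hb)
  have h2 : IntegrableOn (fun _ : ℝ => (1 : ℝ)) (Ioo a b) := integrableOn_const (by simp)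
  refine (h2.add (h1.const_mul a⁻¹)).mono' (hf.mono_set (Ioo_subset_Ioo ha.le hb)) ?_
  filter_upwards [ae_restrict_mem measurableSet_Ioo] with r hr
  have h3 : f r ^ 2 ≤ a⁻¹ * (r * f r ^ 2) := by
    rw [inv_mul_eq_div, le_div_iff₀ ha]
    nlinarith [hr.1, sq_nonneg (f r)]
  simp only [Pi.add_apply]
  rw [Real.norm_eq_abs, abs_le]
  constructor <;> nlinarith [sq_nonneg (f r - 1), sq_nonneg (f r + 1)]

/-- Morrey-type estimate away from the origin. -/
theorem sq_intervalIntegral_le {R : ℝ} {f : ℝ → ℝ}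
    (hf : AEStronglyMeasurable f (volume.restrict (Ioo 0 R)))
    (h : IntegrableOn (fun r => r * f r ^ 2) (Ioo 0 R)) {a b : ℝ} (ha : 0 < a) (hab : a ≤ b)
    (hb : b ≤ R) :
    (∫ r in a..b, f r) ^ 2 ≤ (b - a) / a * ∫ r in Ioo 0 R, r * f r ^ 2 := by
  have hsub : Ioo a b ⊆ Ioo 0 R := Ioo_subset_Ioo ha.le hb
  have hint : IntegrableOn (fun r => r * f r ^ 2) (Ioo a b) := h.mono_set hsub
  have hmono : ∫ r in Ioo a b, r * f r ^ 2 ≤ ∫ r in Ioo 0 R, r * f r ^ 2 := by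
    refine setIntegral_mono_set h ?_ hsub.eventuallyLE
    filter_upwards [ae_restrict_mem measurableSet_Ioo] with r hr
    exact mul_nonneg hr.1.le (sq_nonneg _)
  have hpos : ∀ᵐ r ∂volume.restrict (Ioo a b), 0 ≤ r :=
    (ae_restrict_mem measurableSet_Ioo).mono fun r hr => ha.le.trans hr.1.le
  have hle : ∀ᵐ r ∂volume.restrict (Ioo a b), r * r⁻¹ ^ 2 ≤ a⁻¹ := by
    filter_upwards [ae_restrict_mem measurableSet_Ioo] with r hr
    have h0 : 0 < r := ha.trans hr.1
    have : r * r⁻¹ ^ 2 = r⁻¹ := by field_simp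
    rw [this]
    exact inv_anti₀ ha hr.1.le
  have hinv : IntegrableOn (fun r : ℝ => r * r⁻¹ ^ 2) (Ioo a b) := by
    refine Integrable.mono' (integrable_const (a⁻¹))
      (measurable_id.mul (measurable_inv.pow_const 2)).aestronglyMeasurable ?_
    filter_upwards [hle, hpos] with r h1 h2
    rwa [Real.norm_eq_abs, abs_of_nonneg (by positivity)]
  -- Cauchy–Schwarz with weight r for the pair 1/r, f: the cross term is ∫ f, and r · r⁻² = 1/r ≤
  -- 1/a.
  have hcs := sq_integral_weight_mul_le (μ := volume.restrict (Ioo a b)) hpos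
    measurable_id.aestronglyMeasurable (f := fun r : ℝ => r⁻¹) (g := f)
    measurable_inv.aestronglyMeasurable (hf.mono_set hsub) hinv hint
  have h1 : ∫ r in Ioo a b, r * (r⁻¹ * f r) = ∫ r in a..b, f r := by
    rw [intervalIntegral.integral_of_le hab, integral_Ioc_eq_integral_Ioo]
    refine setIntegral_congr_fun measurableSet_Ioo fun r hr => ?_
    have : r ≠ 0 := (ha.trans hr.1).ne'
    field_simp
  have h2 : ∫ r in Ioo a b, r * r⁻¹ ^ 2 ≤ (b - a) / a := by
    refine (integral_mono_ae hinv (integrable_const _) hle).trans (le_of_eq ?_)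
    simp [hab, div_eq_mul_inv]
  rw [h1] at hcs
  refine hcs.trans (mul_le_mul h2 hmono ?_ ?_)
  · exact integral_nonneg_of_ae (hpos.mono fun r hr => by positivity)
  · exact div_nonneg (by linarith) ha.le

/-! ### Functions of finite energy -/

/-- Functions on `(0, R]` of finite energy vanishing at `R`; no condition is imposed at `0`. -/
structure FiniteEnergy (R : ℝ) (u : ℝ → ℝ) : Prop where
  ac : ∀ a ∈ Ioc 0 R, AbsolutelyContinuousOnInterval u a R
  right_boundary : u R = 0
  integrableOn_deriv : IntegrableOn (fun r => r * deriv u r ^ 2) (Ioo 0 R)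
  integrableOn_inv : IntegrableOn (fun r => r⁻¹ * u r ^ 2) (Ioo 0 R)

theorem ae_mem_Ioo (R : ℝ) : ∀ᵐ r ∂volume.restrict (Ioo 0 R), r ∈ Ioo 0 R :=
  ae_restrict_mem measurableSet_Ioo

theorem ae_Ioo_pos (R : ℝ) : ∀ᵐ r ∂volume.restrict (Ioo 0 R), (0 : ℝ) ≤ r :=
  (ae_mem_Ioo R).mono fun _ h => h.1.le

theorem ae_Ioo_inv_pos (R : ℝ) : ∀ᵐ r ∂volume.restrict (Ioo 0 R), (0 : ℝ) ≤ r⁻¹ :=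
  (ae_mem_Ioo R).mono fun _ h => (inv_pos.2 h.1).le

namespace FiniteEnergy

variable {R : ℝ} {u v : ℝ → ℝ}

theorem ac_Icc (hu : FiniteEnergy R u) {a b : ℝ} (ha : 0 < a) (hab : a ≤ b) (hb : b ≤ R) :
    AbsolutelyContinuousOnInterval u a b :=
  (hu.ac a ⟨ha, hab.trans hb⟩).mono (by
    rw [uIcc_of_le hab, uIcc_of_le (hab.trans hb)]; exact Icc_subset_Icc_right hb)

theorem continuousOn (hu : FiniteEnergy R u) : ContinuousOn u (Ioc 0 R) := by
  intro x hx
  have h := (hu.ac (x / 2) ⟨by linarith [hx.1], by linarith [hx.1, hx.2]⟩).continuousOn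
  rw [uIcc_of_le (by linarith [hx.1, hx.2])] at h
  refine (h x ⟨by linarith [hx.1], hx.2⟩).mono_of_mem_nhdsWithin ?_
  have : Ioi (x / 2) ∈ 𝓝 x := Ioi_mem_nhds (by linarith [hx.1])
  filter_upwards [mem_nhdsWithin_of_mem_nhds this, self_mem_nhdsWithin] with y hy hy'
  exact ⟨le_of_lt hy, hy'.2⟩

theorem aestronglyMeasurable (hu : FiniteEnergy R u) :
    AEStronglyMeasurable u (volume.restrict (Ioo 0 R)) :=
  (hu.continuousOn.mono Ioo_subset_Ioc_self).aestronglyMeasurable measurableSet_Ioo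

theorem intervalIntegrable_deriv (hu : FiniteEnergy R u) {a b : ℝ} (ha : 0 < a) (hab : a ≤ b)
    (hb : b ≤ R) : IntervalIntegrable (deriv u) volume a b :=
  (hu.ac_Icc ha hab hb).intervalIntegrable_deriv

theorem integral_deriv (hu : FiniteEnergy R u) {a b : ℝ} (ha : 0 < a) (hab : a ≤ b) (hb : b ≤ R) :
    ∫ r in a..b, deriv u r = u b - u a :=
  (hu.ac_Icc ha hab hb).integral_deriv_eq_sub

/-- The intervals [R/(k+2), R] exhaust (0, R], and a countable union of null sets is null. -/
theorem ae_of_forall_Icc {P : ℝ → Prop}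
    (h : ∀ a ∈ Ioo 0 R, ∀ᵐ x, x ∈ Icc a R → P x) :
    ∀ᵐ x ∂volume.restrict (Ioo 0 R), P x := by
  rw [ae_restrict_iff' measurableSet_Ioo]
  rcases le_or_gt R 0 with hR | hR
  · exact Eventually.of_forall fun x hx => absurd (hx.1.trans hx.2) (not_lt.2 hR)
  have h' : ∀ k : ℕ, ∀ᵐ x, x ∈ Icc (R / (k + 2)) R → P x := fun k =>
    h _ ⟨by positivity, by rw [div_lt_iff₀ (by positivity)]; nlinarith [(k.cast_nonneg : (0:ℝ) ≤ k)]⟩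
  filter_upwards [ae_all_iff.2 h'] with x hx hxR
  obtain ⟨k, hk⟩ := exists_nat_gt (R / x)
  refine hx k ⟨?_, hxR.2.le⟩
  rw [div_lt_iff₀ hxR.1] at hk
  rw [div_le_iff₀ (by positivity)]
  nlinarith [hxR.1]

theorem ae_differentiableAt (hu : FiniteEnergy R u) :
    ∀ᵐ x ∂volume.restrict (Ioo 0 R), DifferentiableAt ℝ u x :=
  ae_of_forall_Icc fun a ha => by
    simpa [uIcc_of_le ha.2.le] using (hu.ac a ⟨ha.1, ha.2.le⟩).ae_differentiableAt

theorem aestronglyMeasurable_deriv (u : ℝ → ℝ) (R : ℝ) :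
    AEStronglyMeasurable (deriv u) (volume.restrict (Ioo 0 R)) :=
  (measurable_deriv u).aestronglyMeasurable

theorem aesm_id (R : ℝ) : AEStronglyMeasurable (fun r : ℝ => r) (volume.restrict (Ioo 0 R)) :=
  measurable_id.aestronglyMeasurable

theorem aesm_inv (R : ℝ) : AEStronglyMeasurable (fun r : ℝ => r⁻¹) (volume.restrict (Ioo 0 R)) :=
  measurable_inv.aestronglyMeasurable

theorem integrableOn_sq (hu : FiniteEnergy R u) : IntegrableOn (fun r => r * u r ^ 2) (Ioo 0 R) := by
  refine (hu.integrableOn_inv.const_mul (R ^ 2)).mono'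
    ((aesm_id R).mul (hu.aestronglyMeasurable.pow 2)) ?_
  filter_upwards [ae_mem_Ioo R] with r hr
  have hr0 := hr.1
  rw [Real.norm_eq_abs, abs_of_nonneg (by positivity), ← mul_assoc]
  refine mul_le_mul_of_nonneg_right ?_ (sq_nonneg _)
  rw [← div_eq_mul_inv, le_div_iff₀ hr0]
  nlinarith [hr.2]

theorem integrableOn_mul (hu : FiniteEnergy R u) (hv : FiniteEnergy R v) :
    IntegrableOn (fun r => r * (u r * v r)) (Ioo 0 R) :=
  integrable_weight_mul (ae_Ioo_pos R) (aesm_id R) hu.aestronglyMeasurable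
    hv.aestronglyMeasurable hu.integrableOn_sq hv.integrableOn_sq

theorem integrableOn_inv_mul (hu : FiniteEnergy R u) (hv : FiniteEnergy R v) :
    IntegrableOn (fun r => r⁻¹ * (u r * v r)) (Ioo 0 R) :=
  integrable_weight_mul (ae_Ioo_inv_pos R) (aesm_inv R) hu.aestronglyMeasurable
    hv.aestronglyMeasurable hu.integrableOn_inv hv.integrableOn_inv

theorem integrableOn_deriv_mul (hu : FiniteEnergy R u) (hv : FiniteEnergy R v) :
    IntegrableOn (fun r => r * (deriv u r * deriv v r)) (Ioo 0 R) :=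
  integrable_weight_mul (ae_Ioo_pos R) (aesm_id R) (aestronglyMeasurable_deriv u R)
    (aestronglyMeasurable_deriv v R) hu.integrableOn_deriv hv.integrableOn_deriv

theorem ae_deriv_add_mul (hu : FiniteEnergy R u) (hv : FiniteEnergy R v) (t : ℝ) :
    ∀ᵐ r ∂volume.restrict (Ioo 0 R),
      deriv (fun r => u r + t * v r) r = deriv u r + t * deriv v r := by
  filter_upwards [hu.ae_differentiableAt, hv.ae_differentiableAt] with r h1 h2
  exact (h1.hasDerivAt.add (h2.hasDerivAt.const_mul t)).deriv

theorem add_mul (hu : FiniteEnergy R u) (hv : FiniteEnergy R v) (t : ℝ) :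
    FiniteEnergy R (fun r => u r + t * v r) where
  ac a ha := (hu.ac a ha).add ((hv.ac a ha).const_mul t)
  right_boundary := by simp [hu.right_boundary, hv.right_boundary]
  integrableOn_deriv := by
    have h := ((hu.integrableOn_deriv.add ((hu.integrableOn_deriv_mul hv).const_mul (2 * t))).add
      (hv.integrableOn_deriv.const_mul (t ^ 2)))
    refine h.congr ?_
    filter_upwards [hu.ae_deriv_add_mul hv t] with r hr
    simp only [Pi.add_apply]
    rw [hr]; ring
  integrableOn_inv := by
    have h := ((hu.integrableOn_inv.add ((hu.integrableOn_inv_mul hv).const_mul (2 * t))).add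
      (hv.integrableOn_inv.const_mul (t ^ 2)))
    refine h.congr (Eventually.of_forall fun r => ?_)
    simp only [Pi.add_apply]
    ring

theorem zero (R : ℝ) : FiniteEnergy R (fun _ => 0) where
  ac a _ := ((LipschitzWith.const (0 : ℝ)).lipschitzOnWith
    (s := uIcc a R)).absolutelyContinuousOnInterval
  right_boundary := rfl
  integrableOn_deriv := by simp
  integrableOn_inv := by simp

theorem const_mul (hu : FiniteEnergy R u) (t : ℝ) : FiniteEnergy R (fun r => t * u r) := by
  simpa using (zero R).add_mul hu t

theorem sq_sub_le (hu : FiniteEnergy R u) {a b : ℝ} (ha : 0 < a) (hab : a ≤ b) (hb : b ≤ R) :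
    (u b - u a) ^ 2 ≤ (b - a) / a * ∫ r in Ioo 0 R, r * deriv u r ^ 2 := by
  rw [← hu.integral_deriv ha hab hb]
  exact sq_intervalIntegral_le (aestronglyMeasurable_deriv u R) hu.integrableOn_deriv ha hab hb

/-- The Morrey estimate between r and R, where u vanishes. The bound is uniform over sets of bounded
Dirichlet energy and serves as the dominating function in all later limits. -/
theorem sq_le (hu : FiniteEnergy R u) {r : ℝ} (hr : r ∈ Ioc 0 R) :
    r * u r ^ 2 ≤ R * ∫ r in Ioo 0 R, r * deriv u r ^ 2 := by
  have h := hu.sq_sub_le hr.1 hr.2 le_rfl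
  have h0 : 0 ≤ ∫ r in Ioo 0 R, r * deriv u r ^ 2 :=
    integral_nonneg_of_ae ((ae_Ioo_pos R).mono fun r hr => by positivity)
  rw [hu.right_boundary, zero_sub, neg_sq, div_mul_eq_mul_div, le_div_iff₀ hr.1] at h
  nlinarith [hr.1]

theorem abs (hu : FiniteEnergy R u) : FiniteEnergy R (fun r => |u r|) ∧
    ∀ᵐ r ∂volume.restrict (Ioo 0 R), deriv (fun r => |u r|) r ^ 2 ≤ deriv u r ^ 2 := by
  have hle : ∀ᵐ r ∂volume.restrict (Ioo 0 R), deriv (fun r => |u r|) r ^ 2 ≤ deriv u r ^ 2 := by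
    filter_upwards [hu.ae_differentiableAt] with r hr
    by_cases h0 : DifferentiableAt ℝ (fun r => |u r|) r
    · have h1 := h0.hasDerivAt.tendsto_slope.abs
      have h2 := hr.hasDerivAt.tendsto_slope.abs
      -- The difference quotients of |u| are dominated by those of u, so no case distinction on the
      -- sign of u is needed.
      rw [sq_le_sq]
      refine le_of_tendsto_of_tendsto h1 h2 (Eventually.of_forall fun y => ?_)
      simp only [slope_def_field, abs_div]
      exact div_le_div_of_nonneg_right (abs_abs_sub_abs_le _ _) (abs_nonneg _)
    · rw [deriv_zero_of_not_differentiableAt h0]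
      nlinarith [sq_nonneg (deriv u r)]
  refine ⟨⟨fun a ha => (hu.ac a ha).fun_abs, by simp [hu.right_boundary], ?_, ?_⟩, hle⟩
  · refine hu.integrableOn_deriv.mono'
      ((aesm_id R).mul ((aestronglyMeasurable_deriv _ R).pow 2)) ?_
    filter_upwards [hle, ae_Ioo_pos R] with r h1 h2
    rw [Real.norm_eq_abs, abs_of_nonneg (by positivity)]
    exact mul_le_mul_of_nonneg_left h1 h2
  · simpa using hu.integrableOn_inv

end FiniteEnergy

/-! ### The quadratic and logarithmic parts of the action -/

/-- The `L²(r dr)` inner product. -/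
def massForm (R : ℝ) (u v : ℝ → ℝ) : ℝ := ∫ r in Ioo 0 R, r * (u r * v r)

/-- The energy inner product `∫ (r u' v' + n² u v / r) dr`. -/
def kinForm (n : ℤ) (R : ℝ) (u v : ℝ → ℝ) : ℝ :=
  ∫ r in Ioo 0 R, (r * (deriv u r * deriv v r) + (n : ℝ) ^ 2 * (r⁻¹ * (u r * v r)))

/-- The logarithmic potential `∫ r ln(1 + α u²) dr`. -/
def logPotential (α R : ℝ) (u : ℝ → ℝ) : ℝ := ∫ r in Ioo 0 R, r * Real.log (1 + α * u r ^ 2)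

/-- The derivative of the logarithmic potential. -/
def logForm (α R : ℝ) (u v : ℝ → ℝ) : ℝ :=
  ∫ r in Ioo 0 R, r * (2 * α * (u r * v r) / (1 + α * u r ^ 2))

/-- The part of the action that is not determined by the energy flux. -/
def reducedAction (n : ℤ) (α R : ℝ) (u : ℝ → ℝ) : ℝ :=
  (1 / 2) * kinForm n R u u + (α⁻¹) ^ 2 * logPotential α R u

theorem one_le_one_add_mul_sq {α : ℝ} (hα : 0 < α) (x : ℝ) : 1 ≤ 1 + α * x ^ 2 := by
  nlinarith [mul_nonneg hα.le (sq_nonneg x)]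

theorem log_one_add_mul_sq_nonneg {α : ℝ} (hα : 0 < α) (x : ℝ) : 0 ≤ Real.log (1 + α * x ^ 2) :=
  Real.log_nonneg (one_le_one_add_mul_sq hα x)

theorem log_one_add_mul_sq_le {α : ℝ} (hα : 0 < α) (x : ℝ) :
    Real.log (1 + α * x ^ 2) ≤ α * x ^ 2 := by
  have := Real.log_le_sub_one_of_pos (lt_of_lt_of_le one_pos (one_le_one_add_mul_sq hα x))
  linarith

theorem log_mono {α x y : ℝ} (hα : 0 < α) (h : x ^ 2 ≤ y ^ 2) :
    Real.log (1 + α * x ^ 2) ≤ Real.log (1 + α * y ^ 2) :=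
  Real.log_le_log (lt_of_lt_of_le one_pos (one_le_one_add_mul_sq hα x)) (by gcongr)

/-- Bernoulli's inequality 1 + c² s ≤ (1 + s)^(c²) with s = α x². -/
theorem log_scale_le {α c : ℝ} (hα : 0 < α) (hc : 1 ≤ c ^ 2) (x : ℝ) :
    Real.log (1 + α * (c * x) ^ 2) ≤ c ^ 2 * Real.log (1 + α * x ^ 2) := by
  have h0 : 0 ≤ α * x ^ 2 := by positivity
  have h1 := one_add_mul_self_le_rpow_one_add (s := α * x ^ 2) (by linarith) hc
  rw [← Real.log_rpow (by linarith)]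
  refine Real.log_le_log (by positivity) (le_trans (le_of_eq ?_) h1)
  ring

/-- A bound on the derivative of x ↦ ln(1 + α x²) independent of x, from 2|x| ≤ 1 + x². It provides
the domination for differentiating `logPotential`. -/
theorem two_mul_div_one_add_le {α : ℝ} (hα : 0 < α) (x : ℝ) :
    |2 * α * x / (1 + α * x ^ 2)| ≤ 1 + α := by
  have h := one_le_one_add_mul_sq hα x
  rw [abs_div, abs_of_pos (a := 1 + α * x ^ 2) (by linarith), div_le_iff₀ (by linarith), abs_le]
  constructor <;> nlinarith [mul_nonneg hα.le (sq_nonneg (x - 1)),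
    mul_nonneg hα.le (sq_nonneg (x + 1)), mul_nonneg (mul_nonneg hα.le hα.le) (sq_nonneg x)]

variable {n : ℤ} {α R : ℝ} {u v : ℝ → ℝ}

namespace FiniteEnergy

theorem integrableOn_log (hα : 0 < α) (hu : FiniteEnergy R u) :
    IntegrableOn (fun r => r * Real.log (1 + α * u r ^ 2)) (Ioo 0 R) := by
  refine (hu.integrableOn_sq.const_mul α).mono' ((aesm_id R).mul
    (Real.measurable_log.comp_aemeasurable
      (((hu.aestronglyMeasurable.pow 2).const_mul α).const_add 1).aemeasurable).aestronglyMeasurable) ?_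
  filter_upwards [ae_Ioo_pos R] with r hr
  rw [Real.norm_eq_abs, abs_of_nonneg (mul_nonneg hr (log_one_add_mul_sq_nonneg hα _))]
  nlinarith [mul_le_mul_of_nonneg_left (log_one_add_mul_sq_le hα (u r)) hr]

theorem integrableOn_kin (hu : FiniteEnergy R u) (hv : FiniteEnergy R v) (n : ℤ) :
    IntegrableOn (fun r => r * (deriv u r * deriv v r) + (n : ℝ) ^ 2 * (r⁻¹ * (u r * v r)))
      (Ioo 0 R) :=
  (hu.integrableOn_deriv_mul hv).add ((hu.integrableOn_inv_mul hv).const_mul _)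

theorem massForm_add_mul (hu : FiniteEnergy R u) (hv : FiniteEnergy R v) (t : ℝ) :
    massForm R (fun r => u r + t * v r) (fun r => u r + t * v r)
      = massForm R u u + 2 * t * massForm R u v + t ^ 2 * massForm R v v := by
  have h := integral_linear_combination (hu.integrableOn_mul hu) (hu.integrableOn_mul hv)
    (hv.integrableOn_mul hv) 1 (2 * t) (t ^ 2)
  rw [one_mul] at h
  refine Eq.trans ?_ h
  rw [massForm]
  congr 1; ext r; ring

theorem massForm_add_mul_right {w : ℝ → ℝ} (hw : FiniteEnergy R w) (hu : FiniteEnergy R u)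
    (hv : FiniteEnergy R v) (t : ℝ) :
    massForm R w (fun r => u r + t * v r) = massForm R w u + t * massForm R w v := by
  have h := integral_linear_combination (hw.integrableOn_mul hu) (hw.integrableOn_mul hv)
    (hw.integrableOn_mul hv) 1 t 0
  rw [one_mul, zero_mul, add_zero] at h
  refine Eq.trans ?_ h
  rw [massForm]
  congr 1; ext r; ring

theorem kinForm_add_mul_right {w : ℝ → ℝ} (hw : FiniteEnergy R w) (hu : FiniteEnergy R u)
    (hv : FiniteEnergy R v) (t : ℝ) :
    kinForm n R w (fun r => u r + t * v r) = kinForm n R w u + t * kinForm n R w v := by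
  have h := integral_linear_combination (hw.integrableOn_kin hu n) (hw.integrableOn_kin hv n)
    (hw.integrableOn_kin hv n) 1 t 0
  rw [one_mul, zero_mul, add_zero] at h
  refine Eq.trans ?_ h
  rw [kinForm]
  refine integral_congr_ae ?_
  filter_upwards [hu.ae_deriv_add_mul hv t] with r hr
  rw [hr]; ring

theorem kinForm_add_mul (hu : FiniteEnergy R u) (hv : FiniteEnergy R v) (t : ℝ) :
    kinForm n R (fun r => u r + t * v r) (fun r => u r + t * v r)
      = kinForm n R u u + 2 * t * kinForm n R u v + t ^ 2 * kinForm n R v v := by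
  have h := integral_linear_combination (hu.integrableOn_kin hu n) (hu.integrableOn_kin hv n)
    (hv.integrableOn_kin hv n) 1 (2 * t) (t ^ 2)
  rw [one_mul] at h
  refine Eq.trans ?_ h
  rw [kinForm]
  refine integral_congr_ae ?_
  filter_upwards [hu.ae_deriv_add_mul hv t] with r hr
  rw [hr]; ring

theorem integrableOn_logForm (hα : 0 < α) (hu : FiniteEnergy R u) (hv : FiniteEnergy R v) :
    IntegrableOn (fun r => r * (2 * α * (u r * v r) / (1 + α * u r ^ 2))) (Ioo 0 R) := by
  refine ((hu.integrableOn_mul hv).norm.const_mul (2 * α)).mono' ((aesm_id R).mul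
    ((((hu.aestronglyMeasurable.mul hv.aestronglyMeasurable).const_mul (2 * α)).aemeasurable.div
      (((hu.aestronglyMeasurable.pow 2).const_mul α).const_add 1).aemeasurable).aestronglyMeasurable)) ?_
  filter_upwards [ae_Ioo_pos R] with r hr
  have h := one_le_one_add_mul_sq hα (u r)
  simp only [Real.norm_eq_abs, abs_mul, abs_div]
  rw [abs_of_nonneg (a := 1 + α * u r ^ 2) (by linarith), abs_of_nonneg hr, abs_two, abs_of_pos hα,
    mul_div_assoc', div_le_iff₀ (by linarith)]
  have h2 : 0 ≤ r * (2 * α * (|u r| * |v r|)) := by positivity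
  nlinarith

theorem logForm_add_mul_right (hα : 0 < α) {w : ℝ → ℝ} (hw : FiniteEnergy R w)
    (hu : FiniteEnergy R u) (hv : FiniteEnergy R v) (t : ℝ) :
    logForm α R w (fun r => u r + t * v r) = logForm α R w u + t * logForm α R w v := by
  have h := integral_linear_combination (hw.integrableOn_logForm hα hu)
    (hw.integrableOn_logForm hα hv) (hw.integrableOn_logForm hα hv) 1 t 0
  rw [one_mul, zero_mul, add_zero] at h
  refine Eq.trans ?_ h
  rw [logForm]
  congr 1; ext r; ring

theorem integrableOn_linear (hv : FiniteEnergy R v) : IntegrableOn (fun r => r * |v r|) (Ioo 0 R) := by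
  have h1 : IntegrableOn (fun r : ℝ => r * (1:ℝ)^2) (Ioo 0 R) := by
    have : Continuous fun r : ℝ => r * (1:ℝ) ^ 2 := by fun_prop
    exact this.integrableOn_Icc.mono_set Ioo_subset_Icc_self
  have h := (integrable_weight_mul (ae_Ioo_pos R) (aesm_id R) (f := fun _ => (1:ℝ)) (g := v)
    aestronglyMeasurable_const hv.aestronglyMeasurable h1 hv.integrableOn_sq).norm
  refine h.congr ?_
  filter_upwards [ae_Ioo_pos R] with r hr
  simp [abs_of_nonneg hr]

/-- Differentiation under the integral sign, with the t-derivative dominated by (1 + α) r |v| for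
all t. -/
theorem hasDerivAt_logPotential (hα : 0 < α) (hu : FiniteEnergy R u) (hv : FiniteEnergy R v) :
    HasDerivAt (fun t : ℝ => logPotential α R (fun r => u r + t * v r)) (logForm α R u v) 0 := by
  have h := hasDerivAt_integral_of_dominated_loc_of_deriv_le (μ := volume.restrict (Ioo 0 R))
    (F := fun (t : ℝ) r => r * Real.log (1 + α * (u r + t * v r) ^ 2))
    (F' := fun (t : ℝ) r => r * (2 * α * (u r + t * v r) / (1 + α * (u r + t * v r) ^ 2) * v r))
    (bound := fun r => (1 + α) * (r * |v r|)) (x₀ := (0 : ℝ)) (s := univ) univ_mem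
    (Eventually.of_forall fun t => ((hu.add_mul hv t).integrableOn_log hα).aestronglyMeasurable)
    (by simpa [IntegrableOn] using hu.integrableOn_log hα)
    ?_ ?_ (hv.integrableOn_linear.const_mul _) ?_
  · have h2 := h.2
    refine h2.congr_deriv ?_
    rw [logForm]
    congr 1; ext r; simp only [zero_mul, add_zero]; ring
  · have := (hu.integrableOn_logForm hα hv).aestronglyMeasurable
    refine this.congr (Eventually.of_forall fun r => ?_)
    simp only [zero_mul, add_zero]; ring
  · filter_upwards [ae_Ioo_pos R] with r hr t _
    rw [Real.norm_eq_abs, abs_mul, abs_mul, abs_of_nonneg hr]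
    have := two_mul_div_one_add_le hα (u r + t * v r)
    nlinarith [mul_le_mul_of_nonneg_right this (mul_nonneg hr (abs_nonneg (v r)))]
  · refine Eventually.of_forall fun r t _ => ?_
    have h1 := one_le_one_add_mul_sq hα (u r + t * v r)
    have h2 : HasDerivAt (fun t : ℝ => u r + t * v r) (v r) t := by
      simpa using ((hasDerivAt_id t).mul_const (v r)).const_add (u r)
    have h3 := ((((h2.pow 2).const_mul α).const_add 1).log (by simp; linarith)).const_mul r
    refine h3.congr_deriv ?_
    simp only [Pi.pow_apply]
    ring

theorem hasDerivAt_reducedAction (n : ℤ) (hα : 0 < α) (hu : FiniteEnergy R u)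
    (hv : FiniteEnergy R v) :
    HasDerivAt (fun t : ℝ => reducedAction n α R (fun r => u r + t * v r))
      (kinForm n R u v + (α⁻¹) ^ 2 * logForm α R u v) 0 := by
  have h1 : HasDerivAt (fun t : ℝ => kinForm n R u u + 2 * t * kinForm n R u v
      + t ^ 2 * kinForm n R v v) (2 * kinForm n R u v) 0 := by
    have h2 := (((hasDerivAt_id (0:ℝ)).const_mul 2).mul_const (kinForm n R u v)).const_add
      (kinForm n R u u)
    have h3 := ((hasDerivAt_id (0:ℝ)).pow 2).mul_const (kinForm n R v v)
    refine (h2.add h3).congr_deriv ?_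
    simp
  have h4 := (h1.const_mul (1 / 2)).add ((hu.hasDerivAt_logPotential hα hv).const_mul ((α⁻¹) ^ 2))
  simp only [reducedAction]
  simp_rw [hu.kinForm_add_mul hv]
  refine h4.congr_deriv ?_
  ring

/-- The subtracted term depends on u only through its flux, so under the constraint the two
functionals have the same minimisers. -/
theorem action_eq (n : ℤ) (hα : 0 < α) (hu : FiniteEnergy R u) :
    action n α R u = reducedAction n α R u - α⁻¹ * massForm R u u := by
  have h := integral_linear_combination (hu.integrableOn_kin hu n) (hu.integrableOn_mul hu)
    (hu.integrableOn_log hα) 1 (-2 * α⁻¹) (2 * (α⁻¹) ^ 2)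
  have h2 : action n α R u = (1 / 2) * ∫ r in Ioo 0 R,
      (1 * (r * (deriv u r * deriv u r) + (n : ℝ) ^ 2 * (r⁻¹ * (u r * u r)))
        + (-2 * α⁻¹) * (r * (u r * u r)) + 2 * (α⁻¹) ^ 2 * (r * Real.log (1 + α * u r ^ 2))) := by
    rw [action]
    congr 2; ext r
    rw [div_eq_mul_inv]; ring
  rw [h2, h, reducedAction, kinForm, massForm, logPotential]
  ring

end FiniteEnergy

theorem flux_eq (R : ℝ) (u : ℝ → ℝ) : flux R u = 2 * Real.pi * massForm R u u := by
  simp only [flux, massForm, pow_two]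

theorem massForm_self_nonneg (R : ℝ) (u : ℝ → ℝ) : 0 ≤ massForm R u u :=
  integral_nonneg_of_ae ((ae_Ioo_pos R).mono fun _ hr => mul_nonneg hr (mul_self_nonneg _))

theorem kinForm_self_nonneg (n : ℤ) (R : ℝ) (u : ℝ → ℝ) : 0 ≤ kinForm n R u u :=
  integral_nonneg_of_ae ((ae_mem_Ioo R).mono fun _ hr => add_nonneg
    (mul_nonneg hr.1.le (mul_self_nonneg _))
    (mul_nonneg (sq_nonneg _) (mul_nonneg (inv_pos.2 hr.1).le (mul_self_nonneg _))))

theorem logPotential_nonneg (hα : 0 < α) (R : ℝ) (u : ℝ → ℝ) : 0 ≤ logPotential α R u :=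
  integral_nonneg_of_ae ((ae_Ioo_pos R).mono fun _ hr =>
    mul_nonneg hr (log_one_add_mul_sq_nonneg hα _))

theorem reducedAction_nonneg (n : ℤ) (hα : 0 < α) (R : ℝ) (u : ℝ → ℝ) :
    0 ≤ reducedAction n α R u := by
  have h1 := kinForm_self_nonneg n R u
  have h2 := logPotential_nonneg hα R u
  rw [reducedAction]; positivity

theorem massForm_const_mul (R : ℝ) (u : ℝ → ℝ) (c : ℝ) :
    massForm R (fun r => c * u r) (fun r => c * u r) = c ^ 2 * massForm R u u := by
  rw [massForm, massForm, ← integral_const_mul]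
  congr 1; ext r; ring

theorem kinForm_const_mul (n : ℤ) (R : ℝ) (u : ℝ → ℝ) (c : ℝ) :
    kinForm n R (fun r => c * u r) (fun r => c * u r) = c ^ 2 * kinForm n R u u := by
  rw [kinForm, kinForm, ← integral_const_mul]
  congr 1; ext r
  rw [deriv_const_mul_field]; ring

namespace FiniteEnergy

/-- The kinetic part is exactly 2-homogeneous and the logarithm grows at most quadratically under
dilation. -/
theorem reducedAction_const_mul_le (hα : 0 < α) (hu : FiniteEnergy R u) {c : ℝ} (hc : 1 ≤ c ^ 2) :
    reducedAction n α R (fun r => c * u r) ≤ c ^ 2 * reducedAction n α R u := by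
  have h : logPotential α R (fun r => c * u r) ≤ c ^ 2 * logPotential α R u := by
    rw [logPotential, logPotential, ← integral_const_mul]
    refine integral_mono_ae ((hu.const_mul c).integrableOn_log hα)
      ((hu.integrableOn_log hα).const_mul _) ?_
    filter_upwards [ae_Ioo_pos R] with r hr
    nlinarith [mul_le_mul_of_nonneg_left (log_scale_le hα hc (u r)) hr]
  have h2 := mul_le_mul_of_nonneg_left h (sq_nonneg (α⁻¹))
  rw [reducedAction, reducedAction, kinForm_const_mul]
  linarith

theorem reducedAction_const_mul_le_of_le_one (hα : 0 < α) (hu : FiniteEnergy R u) {c : ℝ}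
    (hc : c ^ 2 ≤ 1) : reducedAction n α R (fun r => c * u r) ≤ reducedAction n α R u := by
  have h : logPotential α R (fun r => c * u r) ≤ logPotential α R u := by
    refine integral_mono_ae ((hu.const_mul c).integrableOn_log hα) (hu.integrableOn_log hα) ?_
    filter_upwards [ae_Ioo_pos R] with r hr
    exact mul_le_mul_of_nonneg_left
      (log_mono hα (by rw [mul_pow]; nlinarith [sq_nonneg (u r)])) hr
  have h2 := mul_le_mul_of_nonneg_left h (sq_nonneg (α⁻¹))
  rw [reducedAction, reducedAction, kinForm_const_mul]
  nlinarith [kinForm_self_nonneg n R u]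

theorem reducedAction_abs_le (hu : FiniteEnergy R u) :
    reducedAction n α R (fun r => |u r|) ≤ reducedAction n α R u := by
  have h : kinForm n R (fun r => |u r|) (fun r => |u r|) ≤ kinForm n R u u := by
    refine integral_mono_ae (hu.abs.1.integrableOn_kin hu.abs.1 n) (hu.integrableOn_kin hu n) ?_
    filter_upwards [ae_Ioo_pos R, hu.abs.2] with r hr h
    simp only [abs_mul_abs_self]
    nlinarith [mul_le_mul_of_nonneg_left h hr]
  simp only [reducedAction, logPotential, sq_abs]
  linarith

end FiniteEnergy

theorem massForm_abs (R : ℝ) (u : ℝ → ℝ) :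
    massForm R (fun r => |u r|) (fun r => |u r|) = massForm R u u := by
  simp [massForm]

/-! ### Admissible functions -/

theorem integrableOn_of_energy_lt_top (hα : 0 < α)
    (hum : AEStronglyMeasurable u (volume.restrict (Ioo 0 R))) (he : energy α R u < ⊤) :
    IntegrableOn (fun r => r * deriv u r ^ 2) (Ioo 0 R) ∧
      IntegrableOn (fun r => r⁻¹ * u r ^ 2) (Ioo 0 R) := by
  have hm1 := (FiniteEnergy.aesm_id R).mul ((FiniteEnergy.aestronglyMeasurable_deriv u R).pow 2)
  have hm2 := (FiniteEnergy.aesm_inv R).mul (hum.pow 2)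
  rw [energy] at he
  have key : ∀ f : ℝ → ℝ, AEStronglyMeasurable f (volume.restrict (Ioo 0 R)) →
      (∀ r ∈ Ioo 0 R, 0 ≤ f r ∧ f r ≤ 2 * ((1 / 2) * (r * (deriv u r) ^ 2 + (u r) ^ 2 / r
        + r * Real.log (1 + α * (u r) ^ 2)))) → IntegrableOn f (Ioo 0 R) := by
    intro f hf h
    refine ⟨hf, ?_⟩
    rw [hasFiniteIntegral_iff_ofReal ((ae_mem_Ioo R).mono fun r hr => (h r hr).1)]
    have h3 : ∫⁻ r in Ioo 0 R, ENNReal.ofReal (f r) ≤ ∫⁻ r in Ioo 0 R, ENNReal.ofReal 2 *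
        ENNReal.ofReal ((1 / 2) * (r * (deriv u r) ^ 2 + (u r) ^ 2 / r
          + r * Real.log (1 + α * (u r) ^ 2))) := by
      refine lintegral_mono_ae ((ae_mem_Ioo R).mono fun r hr => ?_)
      rw [← ENNReal.ofReal_mul (by norm_num)]
      exact ENNReal.ofReal_le_ofReal (h r hr).2
    refine h3.trans_lt ?_
    rw [lintegral_const_mul' _ _ ENNReal.ofReal_ne_top]
    exact ENNReal.mul_lt_top ENNReal.ofReal_lt_top he
  refine ⟨key _ hm1 fun r hr => ?_, key _ hm2 fun r hr => ?_⟩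
  all_goals
    have h0 := hr.1
    have h1 := mul_nonneg h0.le (log_one_add_mul_sq_nonneg hα (u r))
    have h2 : 0 ≤ u r ^ 2 / r := by positivity
    have h3 : 0 ≤ r * deriv u r ^ 2 := by positivity
    have h4 : r⁻¹ * u r ^ 2 = u r ^ 2 / r := by rw [div_eq_inv_mul]
    refine ⟨?_, ?_⟩
    · positivity
    · linarith

/-- Each of the three terms of the energy density is nonnegative, hence separately integrable. -/
theorem finiteEnergy_of_energy_lt_top (hα : 0 < α)
    (hac : ∀ a ∈ Ioc 0 R, AbsolutelyContinuousOnInterval u a R) (hR : u R = 0)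
    (hum : AEStronglyMeasurable u (volume.restrict (Ioo 0 R)))
    (he : energy α R u < ⊤) : FiniteEnergy R u :=
  ⟨hac, hR, (integrableOn_of_energy_lt_top hα hum he).1,
    (integrableOn_of_energy_lt_top hα hum he).2⟩

theorem FiniteEnergy.energy_lt_top (hα : 0 < α) (hu : FiniteEnergy R u) : energy α R u < ⊤ := by
  have h : IntegrableOn (fun r => (1 / 2) * (r * (deriv u r) ^ 2 + (u r) ^ 2 / r
      + r * Real.log (1 + α * (u r) ^ 2))) (Ioo 0 R) := by
    refine (((hu.integrableOn_deriv.add hu.integrableOn_inv).add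
      (hu.integrableOn_log hα)).const_mul (1 / 2)).congr (Eventually.of_forall fun r => ?_)
    simp only [Pi.add_apply]
    ring
  exact h.lintegral_lt_top

theorem finiteEnergy_of_mem_admissible (hα : 0 < α) (hR : 0 < R) (hu : u ∈ admissible α R) :
    FiniteEnergy R u := by
  obtain ⟨hac, -, hR0, he⟩ := hu
  refine finiteEnergy_of_energy_lt_top hα (fun a ha => hac.mono ?_) hR0 ?_ he
  · rw [uIcc_of_le ha.2, uIcc_of_le hR.le]; exact Icc_subset_Icc_left ha.1.le
  · have := hac.continuousOn
    rw [uIcc_of_le hR.le] at this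
    exact (this.mono Ioo_subset_Icc_self).aestronglyMeasurable measurableSet_Ioo

/-! ### Nonexistence for small flux -/

namespace FiniteEnergy

theorem integrableOn_abs_mul_deriv (hu : FiniteEnergy R u) :
    IntegrableOn (fun r => r * (|u r| * |deriv u r|)) (Ioo 0 R) := by
  refine integrable_weight_mul (ae_Ioo_pos R) (aesm_id R) hu.aestronglyMeasurable.norm
    (aestronglyMeasurable_deriv u R).norm ?_ ?_
  · simpa [IntegrableOn] using hu.integrableOn_sq
  · simpa [IntegrableOn] using hu.integrableOn_deriv

theorem sq_integral_abs_mul_deriv_le (hu : FiniteEnergy R u) :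
    (∫ r in Ioo 0 R, r * (|u r| * |deriv u r|)) ^ 2
      ≤ massForm R u u * ∫ r in Ioo 0 R, r * deriv u r ^ 2 := by
  have h := sq_integral_weight_mul_le (ae_Ioo_pos R) (aesm_id R) hu.aestronglyMeasurable.norm
    (aestronglyMeasurable_deriv u R).norm (by simpa [IntegrableOn] using hu.integrableOn_sq)
    (by simpa [IntegrableOn] using hu.integrableOn_deriv)
  simp only [Real.norm_eq_abs, sq_abs] at h
  simpa only [massForm, pow_two] using h

theorem intervalIntegral_le_of_nonneg {f : ℝ → ℝ} (hf : IntegrableOn f (Ioo 0 R))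
    (h0 : ∀ r ∈ Ioo 0 R, 0 ≤ f r) {a b : ℝ} (ha : 0 ≤ a) (hab : a ≤ b) (hb : b ≤ R) :
    ∫ r in a..b, f r ≤ ∫ r in Ioo 0 R, f r := by
  rw [intervalIntegral.integral_of_le hab, integral_Ioc_eq_integral_Ioo]
  exact setIntegral_mono_set hf ((ae_mem_Ioo R).mono h0) (Ioo_subset_Ioo ha hb).eventuallyLE

/-- Since u(R) = 0, r u(r)² = -2 ∫ r u u' over (r, R), and r ≤ s there. -/
theorem mul_sq_le_abs_mul_deriv (hu : FiniteEnergy R u) {r : ℝ} (hr : r ∈ Ioc 0 R) :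
    r * u r ^ 2 ≤ 2 * ∫ r in Ioo 0 R, r * (|u r| * |deriv u r|) := by
  have hac := hu.ac r hr
  have h1 := hac.integral_deriv_mul_eq_sub hac
  rw [hu.right_boundary] at h1
  have hi := (intervalIntegrable_iff_integrableOn_Ioo_of_le hr.2).2
    (hu.integrableOn_abs_mul_deriv.mono_set (Ioo_subset_Ioo_left hr.1.le))
  have hi2 := hac.intervalIntegrable_deriv.mul_continuousOn hac.continuousOn
  have hi3 := hac.intervalIntegrable_deriv.continuousOn_mul hac.continuousOn
  have h2 : ∫ s in r..R, -(r * (deriv u s * u s + u s * deriv u s))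
      ≤ ∫ s in r..R, 2 * (s * (|u s| * |deriv u s|)) := by
    refine intervalIntegral.integral_mono_on hr.2 ((hi2.add hi3).const_mul r).neg
      (hi.const_mul 2) fun s hs => ?_
    have h3 := neg_abs_le (u s * deriv u s)
    rw [abs_mul] at h3
    have h4 : 0 ≤ |u s| * |deriv u s| := by positivity
    nlinarith [hs.1, hr.1]
  rw [intervalIntegral.integral_neg, intervalIntegral.integral_const_mul, h1,
    intervalIntegral.integral_const_mul] at h2
  have h5 := intervalIntegral_le_of_nonneg hu.integrableOn_abs_mul_deriv
    (fun s hs => mul_nonneg hs.1.le (by positivity)) hr.1.le hr.2 le_rfl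
  nlinarith

/-- Integrating (r u²)' = u² + 2 r u u' from a to R leaves the boundary term -a u(a)² ≤ 0. -/
theorem integral_sq_le_abs_mul_deriv (hu : FiniteEnergy R u) {a : ℝ} (ha : a ∈ Ioc 0 R) :
    ∫ r in a..R, u r ^ 2 ≤ 2 * ∫ r in Ioo 0 R, r * (|u r| * |deriv u r|) := by
  have hac := hu.ac a ha
  have hid : AbsolutelyContinuousOnInterval (fun x : ℝ => x) a R :=
    (LipschitzWith.id.lipschitzOnWith (s := uIcc a R)).absolutelyContinuousOnInterval
  have h1 := hid.integral_deriv_mul_eq_sub (hac.fun_mul hac)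
  have h1' : ∫ r in a..R, (u r ^ 2 + 2 * (r * (u r * deriv u r))) = - (a * u a ^ 2) := by
    have e : ∫ r in a..R, (u r ^ 2 + 2 * (r * (u r * deriv u r)))
        = R * (u R * u R) - a * (u a * u a) := by
      rw [← h1]
      refine intervalIntegral.integral_congr_ae ?_
      filter_upwards [hac.ae_differentiableAt] with x hx hxI
      have h2 := (hx (uIoc_subset_uIcc hxI)).hasDerivAt
      rw [(h2.fun_mul h2).deriv, deriv_id'']
      ring
    rw [e, hu.right_boundary]; ring
  have hi := (intervalIntegrable_iff_integrableOn_Ioo_of_le ha.2).2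
    (hu.integrableOn_abs_mul_deriv.mono_set (Ioo_subset_Ioo_left ha.1.le))
  have hi2 : IntervalIntegrable (fun r => r * (u r * deriv u r)) volume a R :=
    (hac.intervalIntegrable_deriv.continuousOn_mul hac.continuousOn).continuousOn_mul
      continuousOn_id
  have hi3 : IntervalIntegrable (fun r => u r ^ 2) volume a R :=
    (hac.continuousOn.pow 2).intervalIntegrable
  rw [intervalIntegral.integral_add hi3 (hi2.const_mul 2)] at h1'
  have h3 : ∫ s in a..R, -(2 * (s * (u s * deriv u s)))
      ≤ ∫ s in a..R, 2 * (s * (|u s| * |deriv u s|)) := by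
    refine intervalIntegral.integral_mono_on ha.2 (hi2.const_mul 2).neg
      (hi.const_mul 2) fun s hs => ?_
    have h3 := neg_abs_le (u s * deriv u s)
    rw [abs_mul] at h3
    nlinarith [hs.1, ha.1]
  rw [intervalIntegral.integral_neg, intervalIntegral.integral_const_mul (2 : ℝ)
    (fun s => s * (|u s| * |deriv u s|))] at h3
  have h5 := intervalIntegral_le_of_nonneg hu.integrableOn_abs_mul_deriv
    (fun s hs => mul_nonneg hs.1.le (by positivity)) ha.1.le ha.2 le_rfl
  nlinarith [mul_nonneg ha.1.le (sq_nonneg (u a))]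

/-- A radial Ladyzhenskaya inequality. -/
theorem integral_pow_four_le (hu : FiniteEnergy R u) {a b : ℝ} (ha : 0 < a) (hab : a ≤ b)
    (hb : b ≤ R) :
    ∫ r in a..b, r * u r ^ 4 ≤ 4 * (massForm R u u * ∫ r in Ioo 0 R, r * deriv u r ^ 2) := by
  have hc : ContinuousOn u (uIcc a b) := (hu.ac_Icc ha hab hb).continuousOn
  have hcR : ContinuousOn u (uIcc a R) := (hu.ac_Icc ha (hab.trans hb) le_rfl).continuousOn
  set D := ∫ r in Ioo 0 R, r * (|u r| * |deriv u r|) with hD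
  have hD0 : 0 ≤ D := integral_nonneg_of_ae ((ae_Ioo_pos R).mono fun r hr =>
    mul_nonneg hr (by positivity))
  -- One factor r u² is bounded pointwise by 2D and the remaining ∫ u² again by 2D; then D² ≤ MA by
  -- Cauchy–Schwarz, with M the mass and A the Dirichlet integral.
  have h1 : ∫ r in a..b, r * u r ^ 4 ≤ ∫ r in a..b, (2 * D) * u r ^ 2 := by
    refine intervalIntegral.integral_mono_on hab
      (continuousOn_id.mul (hc.pow 4)).intervalIntegrable
      (((hc.pow 2).intervalIntegrable).const_mul _) fun r hr => ?_
    have := hu.mul_sq_le_abs_mul_deriv (r := r) ⟨ha.trans_le hr.1, hr.2.trans hb⟩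
    nlinarith [mul_le_mul_of_nonneg_right this (sq_nonneg (u r))]
  rw [intervalIntegral.integral_const_mul] at h1
  have h2 : ∫ r in a..b, u r ^ 2 ≤ ∫ r in a..R, u r ^ 2 :=
    intervalIntegral.integral_mono_interval le_rfl hab hb
      (Eventually.of_forall fun r => sq_nonneg _) (hcR.pow 2).intervalIntegrable
  have h3 := hu.integral_sq_le_abs_mul_deriv ⟨ha, hab.trans hb⟩
  have h4 := hu.sq_integral_abs_mul_deriv_le
  rw [← hD] at h3 h4
  nlinarith [mul_le_mul_of_nonneg_left (h2.trans h3) hD0]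

end FiniteEnergy

/-! ### Energy identity for classical solutions -/

namespace IsVortexSolution

variable {κ : ℝ}

theorem differentiableAt (hu : IsVortexSolution n α R κ u) {r : ℝ} (hr : r ∈ Ioo 0 R) :
    DifferentiableAt ℝ u r :=
  (hu.contDiffOn.differentiableOn (by norm_num)).differentiableAt (isOpen_Ioo.mem_nhds hr)

theorem contDiffOn_deriv (hu : IsVortexSolution n α R κ u) : ContDiffOn ℝ 1 (deriv u) (Ioo 0 R) :=
  ((contDiffOn_succ_iff_deriv_of_isOpen (n := 1) isOpen_Ioo).1 hu.contDiffOn).2.2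

theorem hasDerivAt_mul_deriv (hu : IsVortexSolution n α R κ u) {r : ℝ} (hr : r ∈ Ioo 0 R) :
    HasDerivAt (fun s => s * deriv u s) ((n : ℝ) ^ 2 / r * u r
      - 2 * r * (u r) ^ 3 / (1 + α * (u r) ^ 2) + 2 * κ * r * u r) r := by
  have h1 : DifferentiableAt ℝ (deriv u) r :=
    (hu.contDiffOn_deriv.differentiableOn (by norm_num)).differentiableAt (isOpen_Ioo.mem_nhds hr)
  have h2 : DifferentiableAt ℝ (fun s => s * deriv u s) r := differentiableAt_id.mul h1
  refine h2.hasDerivAt.congr_deriv ?_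
  linarith [hu.equation r hr]

/-- A classical solution is only continuous at R; the weighted bound on u' supplies its
integrability up to R. -/
theorem finiteEnergy (hα : 0 < α) (hu : IsVortexSolution n α R κ u) (he : energy α R u < ⊤) :
    FiniteEnergy R u := by
  have hm := (hu.continuousOn.mono Ioo_subset_Icc_self).aestronglyMeasurable
    (measurableSet_Ioo (a := 0) (b := R)) (μ := volume)
  refine finiteEnergy_of_energy_lt_top hα (fun a ha => ?_) hu.right_boundary hm he
  refine absolutelyContinuousOnInterval_of_deriv ha.2
    (hu.continuousOn.mono (Icc_subset_Icc_left ha.1.le))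
    (fun x hx => hu.differentiableAt ⟨ha.1.trans hx.1, hx.2⟩)
    (intervalIntegrable_of_weighted (FiniteEnergy.aestronglyMeasurable_deriv u R)
      (integrableOn_of_energy_lt_top hα hm he).1 ha.1 ha.2 le_rfl)

/-- The mean value theorem for u² on [0, a], with u(0) = 0. Together with `exists_right` it gives
cut-off points where the boundary terms of the energy identity have a favourable sign, so no limit
of r u u' at the endpoints is needed. -/
theorem exists_left (hu : IsVortexSolution n α R κ u) {a : ℝ} (ha : a ∈ Ioo 0 R) :
    ∃ c ∈ Ioo 0 a, 0 ≤ u c * deriv u c := by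
  obtain ⟨c, hc, h⟩ := exists_deriv_eq_slope (fun r => u r * u r) ha.1
    ((hu.continuousOn.mul hu.continuousOn).mono (Icc_subset_Icc_right ha.2.le))
    (fun r hr => ((hu.differentiableAt ⟨hr.1, hr.2.trans ha.2⟩).mul
      (hu.differentiableAt ⟨hr.1, hr.2.trans ha.2⟩)).differentiableWithinAt)
  refine ⟨c, hc, ?_⟩
  have hd := (hu.differentiableAt ⟨hc.1, hc.2.trans ha.2⟩).hasDerivAt
  rw [(hd.fun_mul hd).deriv, hu.left_boundary] at h
  have : 0 ≤ (u a * u a - 0 * 0) / (a - 0) := div_nonneg (by nlinarith [mul_self_nonneg (u a)])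
    (by linarith [ha.1])
  linarith

theorem exists_right (hu : IsVortexSolution n α R κ u) {b : ℝ} (hb : b ∈ Ioo 0 R) :
    ∃ c ∈ Ioo b R, u c * deriv u c ≤ 0 := by
  obtain ⟨c, hc, h⟩ := exists_deriv_eq_slope (fun r => u r * u r) hb.2
    ((hu.continuousOn.mul hu.continuousOn).mono (Icc_subset_Icc_left hb.1.le))
    (fun r hr => ((hu.differentiableAt ⟨hb.1.trans hr.1, hr.2⟩).mul
      (hu.differentiableAt ⟨hb.1.trans hr.1, hr.2⟩)).differentiableWithinAt)
  refine ⟨c, hc, ?_⟩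
  have hd := (hu.differentiableAt ⟨hb.1.trans hc.1, hc.2⟩).hasDerivAt
  rw [(hd.fun_mul hd).deriv, hu.right_boundary] at h
  have : (0 * 0 - u b * u b) / (R - b) ≤ 0 :=
    div_nonpos_of_nonpos_of_nonneg (by nlinarith [mul_self_nonneg (u b)]) (by linarith [hb.2])
  linarith

/-- Multiply the equation by u and integrate by parts. The boundary terms help, the zeroth-order
term is nonnegative by the condition on κ, and the saturation factor 1/(1 + α u²) is at most 1. -/
theorem integral_le (hα : 0 < α) (hu : IsVortexSolution n α R κ u)
    (hκ : ∀ r ∈ Icc 0 R, 0 < (n : ℝ) ^ 2 + 2 * r ^ 2 * κ) {a b : ℝ} (ha : 0 < a) (hab : a ≤ b)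
    (hb : b < R) (hua : 0 ≤ u a * deriv u a) (hub : u b * deriv u b ≤ 0) :
    ∫ r in a..b, r * deriv u r ^ 2 ≤ 2 * ∫ r in a..b, r * u r ^ 4 := by
  have hsub : uIcc a b ⊆ Ioo 0 R := by
    rw [uIcc_of_le hab]; exact fun x hx => ⟨ha.trans_le hx.1, hx.2.trans_lt hb⟩
  have hc : ContinuousOn u (uIcc a b) := hu.contDiffOn.continuousOn.mono hsub
  have hc' : ContinuousOn (deriv u) (uIcc a b) := hu.contDiffOn_deriv.continuousOn.mono hsub
  have hpos : ∀ r, 0 < 1 + α * u r ^ 2 := fun r =>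
    lt_of_lt_of_le one_pos (one_le_one_add_mul_sq hα (u r))
  have hne : ∀ r ∈ uIcc a b, r ≠ 0 := fun r hr => (hsub hr).1.ne'
  set φ' : ℝ → ℝ := fun r => ((n : ℝ) ^ 2 / r * u r
      - 2 * r * (u r) ^ 3 / (1 + α * (u r) ^ 2) + 2 * κ * r * u r) * u r
      + r * deriv u r * deriv u r with hφ'
  have hcφ : ContinuousOn φ' (uIcc a b) := by
    refine ((((continuousOn_const.div continuousOn_id hne).mul hc).sub
      (((continuousOn_const.mul continuousOn_id).mul (hc.pow 3)).div
        (continuousOn_const.add (continuousOn_const.mul (hc.pow 2))) fun r _ => (hpos r).ne')).add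
      ((continuousOn_const.mul continuousOn_id).mul hc)).mul hc |>.add
      ((continuousOn_id.mul hc').mul hc')
  have h1 : ∫ r in a..b, φ' r = b * deriv u b * u b - a * deriv u a * u a :=
    intervalIntegral.integral_eq_sub_of_hasDerivAt (f := fun s => s * deriv u s * u s)
      (fun r hr => (hu.hasDerivAt_mul_deriv (hsub hr)).mul
        (hu.differentiableAt (hsub hr)).hasDerivAt) hcφ.intervalIntegrable
  have hi1 : IntervalIntegrable (fun r => r * deriv u r ^ 2) volume a b :=
    (continuousOn_id.mul (hc'.pow 2)).intervalIntegrable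
  have hi2 : IntervalIntegrable (fun r => 2 * (r * u r ^ 4)) volume a b :=
    (continuousOn_const.mul (continuousOn_id.mul (hc.pow 4))).intervalIntegrable
  have h2 : ∫ r in a..b, (r * deriv u r ^ 2 - 2 * (r * u r ^ 4)) ≤ ∫ r in a..b, φ' r := by
    refine intervalIntegral.integral_mono_on hab (hi1.sub hi2) hcφ.intervalIntegrable fun r hr => ?_
    have hr' := hsub (by rwa [uIcc_of_le hab] : r ∈ uIcc a b)
    have hr0 := hr'.1
    have e : φ' r = r * deriv u r ^ 2 + ((n : ℝ) ^ 2 + 2 * r ^ 2 * κ) * (u r ^ 2 / r)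
        - 2 * r * (u r ^ 4 / (1 + α * u r ^ 2)) := by
      simp only [hφ']
      field_simp
      ring
    have h3 : 0 ≤ ((n : ℝ) ^ 2 + 2 * r ^ 2 * κ) * (u r ^ 2 / r) :=
      mul_nonneg (hκ r (Ioo_subset_Icc_self hr')).le (by positivity)
    have h4 : u r ^ 4 / (1 + α * u r ^ 2) ≤ u r ^ 4 :=
      div_le_self (by positivity) (one_le_one_add_mul_sq hα _)
    rw [e]
    nlinarith [mul_le_mul_of_nonneg_left h4 hr0.le]
  rw [h1, intervalIntegral.integral_sub hi1 hi2, intervalIntegral.integral_const_mul] at h2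
  nlinarith [mul_nonneg ha.le hua, mul_nonneg (ha.trans_le hab).le (neg_nonneg.2 hub)]

theorem eq_zero_of_flux_le (hα : 0 < α) (hR : 0 < R) (hu : IsVortexSolution n α R κ u)
    (hκ : ∀ r ∈ Icc 0 R, 0 < (n : ℝ) ^ 2 + 2 * r ^ 2 * κ) (he : energy α R u < ⊤)
    (hQ : flux R u ≤ 1 / 4) : ∀ r ∈ Icc 0 R, u r = 0 := by
  have hf := hu.finiteEnergy hα he
  set A := ∫ r in Ioo 0 R, r * deriv u r ^ 2 with hA
  have hA0 : 0 ≤ A := integral_nonneg_of_ae ((ae_Ioo_pos R).mono fun r hr =>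
    mul_nonneg hr (sq_nonneg _))
  have hnn : ∀ r ∈ Ioo 0 R, 0 ≤ r * deriv u r ^ 2 := fun r hr => mul_nonneg hr.1.le (sq_nonneg _)
  have hbound : ∀ a b, 0 < a → a ≤ b → b < R →
      ∫ r in a..b, r * deriv u r ^ 2 ≤ 8 * (massForm R u u * A) := by
    intro a b ha hab hb
    obtain ⟨a', ha', hua⟩ := hu.exists_left ⟨ha, hab.trans_lt hb⟩
    obtain ⟨b', hb', hub⟩ := hu.exists_right ⟨ha.trans_le hab, hb⟩
    have hab' : a' ≤ b' := ha'.2.le.trans (hab.trans hb'.1.le)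
    have h1 := hu.integral_le hα hκ ha'.1 hab' hb'.2 hua hub
    have h2 := hf.integral_pow_four_le ha'.1 hab' hb'.2.le
    have h3 : ∫ r in a..b, r * deriv u r ^ 2 ≤ ∫ r in a'..b', r * deriv u r ^ 2 := by
      refine intervalIntegral.integral_mono_interval ha'.2.le hab hb'.1.le ?_
        ((intervalIntegrable_iff_integrableOn_Ioo_of_le hab').2
          (hf.integrableOn_deriv.mono_set (Ioo_subset_Ioo ha'.1.le hb'.2.le)))
      filter_upwards [ae_restrict_mem measurableSet_Ioc] with r hr
      exact mul_nonneg (ha'.1.trans hr.1).le (sq_nonneg _)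
    linarith
  -- The 3 in the denominator keeps R/(k+3) ≤ R - R/(k+3) for every k, k = 0 included.
  have hlim : Tendsto (fun k : ℕ => ∫ r in Ioc (R / (k + 3)) (R - R / (k + 3)),
      r * deriv u r ^ 2 ∂(volume.restrict (Ioo 0 R))) atTop (𝓝 A) := by
    have h0 : Tendsto (fun k : ℕ => R / ((k : ℝ) + 3)) atTop (𝓝 0) :=
      Tendsto.div_atTop tendsto_const_nhds
        (tendsto_atTop_add_const_right _ _ tendsto_natCast_atTop_atTop)
    have h1 : Tendsto (fun k : ℕ => R - R / ((k : ℝ) + 3)) atTop (𝓝 R) := by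
      simpa using h0.const_sub R
    exact (aecover_Ioo_of_Ioc h0 h1).integral_tendsto_of_countably_generated hf.integrableOn_deriv
  have hle : A ≤ 8 * (massForm R u u * A) := by
    refine le_of_tendsto hlim (Eventually.of_forall fun k => ?_)
    have hk : (3 : ℝ) ≤ k + 3 := by linarith [(k.cast_nonneg : (0 : ℝ) ≤ k)]
    have hk3 : R / (k + 3) ≤ R / 3 := div_le_div_of_nonneg_left hR.le (by norm_num) hk
    have hk0 : 0 < R / ((k : ℝ) + 3) := by positivity
    have h := hbound (R / (k + 3)) (R - R / (k + 3)) hk0 (by linarith) (by linarith)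
    rw [intervalIntegral.integral_of_le (by linarith)] at h
    rwa [Measure.restrict_restrict measurableSet_Ioc, inter_eq_left.2]
    exact fun x hx => ⟨hk0.trans hx.1, by linarith [hx.2]⟩
  -- The mass is at most 1/(8π) < 1/24, so the factor 8M is below 1/3.
  have hA' : A = 0 := by
    rw [flux_eq] at hQ
    have h0 := massForm_self_nonneg R u
    have h3 := Real.pi_gt_three
    have h4 : massForm R u u ≤ 1 / 24 := by nlinarith
    nlinarith [mul_le_mul_of_nonneg_right h4 hA0]
  intro r hr
  rcases hr.1.eq_or_lt with h | h
  · rw [← h]; exact hu.left_boundary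
  · have h1 := hf.sq_le ⟨h, hr.2⟩
    rw [← hA, hA', mul_zero] at h1
    have h2 : u r ^ 2 = 0 := le_antisymm (by nlinarith) (sq_nonneg _)
    exact pow_eq_zero_iff (two_ne_zero) |>.1 h2

end IsVortexSolution

/-! ### Limits of sequences of bounded energy -/

/-- Completeness of `L²(r dr)`, stated for functions. -/
theorem exists_weighted_limit {f : ℕ → ℝ → ℝ}
    (hfm : ∀ k, AEStronglyMeasurable (f k) (volume.restrict (Ioo 0 R)))
    (hf : ∀ k, IntegrableOn (fun r => r * f k r ^ 2) (Ioo 0 R))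
    (hc : Tendsto (fun p : ℕ × ℕ => ∫ r in Ioo 0 R, r * (f p.1 r - f p.2 r) ^ 2) atTop (𝓝 0)) :
    ∃ g : ℝ → ℝ, AEStronglyMeasurable g (volume.restrict (Ioo 0 R)) ∧
      IntegrableOn (fun r => r * g r ^ 2) (Ioo 0 R) ∧
      Tendsto (fun k => ∫ r in Ioo 0 R, r * (f k r - g r) ^ 2) atTop (𝓝 0) ∧
      Tendsto (fun k => ∫ r in Ioo 0 R, r * f k r ^ 2) atTop (𝓝 (∫ r in Ioo 0 R, r * g r ^ 2)) := by
  set μ := volume.restrict (Ioo (0 : ℝ) R) with hμ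
  have hsm : AEStronglyMeasurable (fun r : ℝ => √r) μ :=
    Real.continuous_sqrt.aestronglyMeasurable
  -- Multiplication by √r carries L²(r dr) isometrically into the ordinary L², which is complete.
  have hL : ∀ k, MemLp (fun r => √r * f k r) 2 μ := by
    intro k
    refine (memLp_two_iff_integrable_sq (hsm.mul (hfm k))).2 ?_
    refine (hf k).congr ?_
    filter_upwards [ae_Ioo_pos R] with r hr
    simp only [Pi.mul_apply]
    rw [mul_pow, Real.sq_sqrt hr]
  have hnorm : ∀ F : Lp ℝ 2 μ, ‖F‖ ^ 2 = ∫ r, (F r) ^ 2 ∂μ := by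
    intro F
    rw [← real_inner_self_eq_norm_sq, L2.inner_def]
    simp only [real_inner_self_eq_norm_sq, Real.norm_eq_abs, sq_abs]
  set F : ℕ → Lp ℝ 2 μ := fun k => (hL k).toLp with hF
  have hFcoe : ∀ k, F k =ᵐ[μ] fun r => √r * f k r := fun k => (hL k).coeFn_toLp
  have hcau : CauchySeq F := by
    rw [cauchySeq_iff_tendsto_dist_atTop_0]
    have h1 : ∀ p : ℕ × ℕ, dist (F p.1) (F p.2) = √(∫ r in Ioo 0 R, r * (f p.1 r - f p.2 r) ^ 2) := by
      intro p
      rw [dist_eq_norm, ← Real.sqrt_sq (norm_nonneg (F p.1 - F p.2)), hnorm]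
      congr 1
      refine integral_congr_ae ?_
      filter_upwards [Lp.coeFn_sub (F p.1) (F p.2), hFcoe p.1, hFcoe p.2, ae_Ioo_pos R]
        with r h1 h2 h3 h4
      rw [h1, Pi.sub_apply, h2, h3, ← mul_sub, mul_pow, Real.sq_sqrt h4]
    simp_rw [h1]
    have h2 := (Real.continuous_sqrt.tendsto 0).comp hc
    rw [Real.sqrt_zero] at h2
    exact h2
  obtain ⟨G, hG⟩ := cauchySeq_tendsto_of_complete hcau
  have hgm : AEStronglyMeasurable (fun r => (√r)⁻¹ * G r) μ :=
    (Real.continuous_sqrt.measurable.inv.aestronglyMeasurable).mul (Lp.aestronglyMeasurable G)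
  have hg : ∀ᵐ r ∂μ, √r * ((√r)⁻¹ * G r) = G r := by
    filter_upwards [ae_mem_Ioo R] with r hr
    rw [mul_inv_cancel_left₀ (Real.sqrt_pos.2 hr.1).ne']
  refine ⟨fun r => (√r)⁻¹ * G r, hgm, ?_, ?_, ?_⟩
  · have h1 := (memLp_two_iff_integrable_sq (Lp.aestronglyMeasurable G)).1 (Lp.memLp G)
    refine h1.congr ?_
    filter_upwards [ae_Ioo_pos R, hg] with r h1 h2
    rw [← h2, mul_pow, Real.sq_sqrt h1, h2]
  · have h1 : Tendsto (fun k => ‖F k - G‖ ^ 2) atTop (𝓝 0) := by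
      simpa using (tendsto_iff_norm_sub_tendsto_zero.1 hG).pow 2
    refine h1.congr fun k => ?_
    rw [hnorm]
    refine integral_congr_ae ?_
    filter_upwards [Lp.coeFn_sub (F k) G, hFcoe k, ae_Ioo_pos R, hg] with r h1 h2 h3 h4
    rw [h1, Pi.sub_apply, h2]
    conv_lhs => rw [← h4]
    rw [← mul_sub, mul_pow, Real.sq_sqrt h3]
  · have h1 : Tendsto (fun k => ‖F k‖ ^ 2) atTop (𝓝 (‖G‖ ^ 2)) := hG.norm.pow 2
    have h2 : ‖G‖ ^ 2 = ∫ r in Ioo 0 R, r * ((√r)⁻¹ * G r) ^ 2 := by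
      rw [hnorm]
      refine integral_congr_ae ?_
      filter_upwards [ae_Ioo_pos R, hg] with r h3 h4
      conv_lhs => rw [← h4]
      rw [mul_pow, Real.sq_sqrt h3]
    rw [← h2]
    refine h1.congr fun k => ?_
    rw [hnorm]
    refine integral_congr_ae ?_
    filter_upwards [hFcoe k, ae_Ioo_pos R] with r h1 h2
    rw [h1, mul_pow, Real.sq_sqrt h2]

/-- Fatou's lemma for Bochner integrals of nonnegative functions. -/
theorem integrable_of_tendsto_of_integral_tendsto {X : Type*} [MeasurableSpace X] {μ : Measure X}
    {f : ℕ → X → ℝ} {g : X → ℝ} {c : ℝ} (hf : ∀ k, Integrable (f k) μ) (h0 : ∀ k, 0 ≤ᵐ[μ] f k)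
    (hlim : ∀ᵐ x ∂μ, Tendsto (fun k => f k x) atTop (𝓝 (g x)))
    (hc : Tendsto (fun k => ∫ x, f k x ∂μ) atTop (𝓝 c)) :
    Integrable g μ ∧ ∫ x, g x ∂μ ≤ c := by
  have hgm : AEStronglyMeasurable g μ :=
    aestronglyMeasurable_of_tendsto_ae atTop (fun k => (hf k).aestronglyMeasurable) hlim
  have hg0 : 0 ≤ᵐ[μ] g := by
    filter_upwards [hlim, ae_all_iff.2 h0] with x h1 h2
    exact ge_of_tendsto' h1 h2
  have hc0 : 0 ≤ c := ge_of_tendsto' hc fun k => integral_nonneg_of_ae (h0 k)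
  have h1 : ∫⁻ x, ENNReal.ofReal (g x) ∂μ ≤ ENNReal.ofReal c := by
    have h2 : ∫⁻ x, ENNReal.ofReal (g x) ∂μ
        = ∫⁻ x, liminf (fun k => ENNReal.ofReal (f k x)) atTop ∂μ := by
      refine lintegral_congr_ae ?_
      filter_upwards [hlim] with x hx
      exact ((ENNReal.tendsto_ofReal hx).liminf_eq).symm
    rw [h2]
    refine (lintegral_liminf_le' fun k => (hf k).aemeasurable.ennreal_ofReal).trans (le_of_eq ?_)
    have h3 : Tendsto (fun k => ∫⁻ x, ENNReal.ofReal (f k x) ∂μ) atTop (𝓝 (ENNReal.ofReal c)) := by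
      simp_rw [← fun k => ofReal_integral_eq_lintegral_ofReal (hf k) (h0 k)]
      exact ENNReal.tendsto_ofReal hc
    exact h3.liminf_eq
  have hgi : Integrable g μ :=
    ⟨hgm, (hasFiniteIntegral_iff_ofReal hg0).2 (h1.trans_lt ENNReal.ofReal_lt_top)⟩
  refine ⟨hgi, ?_⟩
  rwa [← ofReal_integral_eq_lintegral_ofReal hgi hg0, ENNReal.ofReal_le_ofReal_iff hc0] at h1

/-- A sequence with bounded Dirichlet energy has a pointwise convergent subsequence. -/
theorem exists_pointwise_limit {u : ℕ → ℝ → ℝ} {K : ℝ} (hu : ∀ k, FiniteEnergy R (u k))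
    (hK : ∀ k, ∫ r in Ioo 0 R, r * deriv (u k) r ^ 2 ≤ K) :
    ∃ (φ : ℕ → ℕ) (U : ℝ → ℝ), StrictMono φ ∧
      (∀ r ∈ Ioc 0 R, Tendsto (fun k => u (φ k) r) atTop (𝓝 (U r))) ∧ U 0 = 0 := by
  have hK0 : 0 ≤ K := le_trans (integral_nonneg_of_ae ((ae_Ioo_pos R).mono fun r hr =>
    mul_nonneg hr (sq_nonneg _))) (hK 0)
  -- Diagonal extraction: the values at rational points lie in a countable product of compact
  -- intervals.
  let ι := {q : ℚ // (q : ℝ) ∈ Ioc 0 R}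
  let x : ℕ → ι → ℝ := fun k q => u k q
  let S : Set (ι → ℝ) := Set.pi univ fun q => Icc (-√(R * K / (q.1 : ℝ))) (√(R * K / (q.1 : ℝ)))
  have hS : IsCompact S := isCompact_univ_pi fun q => isCompact_Icc
  have hxS : ∀ k, x k ∈ S := by
    intro k q _
    have h1 := (hu k).sq_le q.2
    have h2 : R * ∫ r in Ioo 0 R, r * deriv (u k) r ^ 2 ≤ R * K :=
      mul_le_mul_of_nonneg_left (hK k) (q.2.1.le.trans q.2.2)
    exact abs_le.1 (Real.abs_le_sqrt (by rw [le_div_iff₀ q.2.1]; linarith))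
  obtain ⟨a, -, φ, hφ, ha⟩ := hS.tendsto_subseq hxS
  have hq : ∀ q : ι, CauchySeq fun k => u (φ k) q := fun q =>
    ((tendsto_pi_nhds.1 ha) q).cauchySeq
  -- Equicontinuity from the Morrey estimate with the common constant K passes from a nearby
  -- rational q < r to r.
  have hcau : ∀ r ∈ Ioc 0 R, CauchySeq fun k => u (φ k) r := by
    intro r hr
    rw [Metric.cauchySeq_iff]
    intro ε hε
    have hcont : Tendsto (fun s : ℝ => (r - s) / s * K) (𝓝 r) (𝓝 ((r - r) / r * K)) :=
      ((tendsto_const_nhds.sub tendsto_id).div tendsto_id hr.1.ne').mul_const K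
    have hev : ∀ᶠ s in 𝓝 r, 0 < s ∧ (r - s) / s * K < (ε / 3) ^ 2 := by
      refine (eventually_gt_nhds hr.1).and (hcont.eventually_lt_const ?_)
      simp; positivity
    obtain ⟨δ, hδ, hball⟩ := Metric.eventually_nhds_iff.1 hev
    obtain ⟨q, hq1, hq2⟩ := exists_rat_btwn (show r - δ < r by linarith)
    have hqr := hball (y := (q : ℝ)) (by rw [Real.dist_eq, abs_lt]; constructor <;> linarith)
    have hqI : (q : ℝ) ∈ Ioc 0 R := ⟨hqr.1, hq2.le.trans hr.2⟩
    obtain ⟨N, hN⟩ := Metric.cauchySeq_iff.1 (hq ⟨q, hqI⟩) (ε / 3) (by positivity)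
    refine ⟨N, fun j hj k hk => ?_⟩
    have hdist : ∀ i, |u (φ i) r - u (φ i) q| < ε / 3 := by
      intro i
      refine abs_lt_of_sq_lt_sq ?_ (by positivity)
      refine lt_of_le_of_lt ((hu (φ i)).sq_sub_le hqr.1 hq2.le hr.2) (lt_of_le_of_lt ?_ hqr.2)
      exact mul_le_mul_of_nonneg_left (hK _) (div_nonneg (by linarith) hqr.1.le)
    have h1 := hN j hj k hk
    have h2 := hdist j
    have h3 := hdist k
    rw [Real.dist_eq, abs_lt] at *
    simp only at h1
    constructor <;> linarith [h1.1, h1.2, h2.1, h2.2, h3.1, h3.2]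
  choose! U hU using fun r hr => cauchySeq_tendsto_of_complete (hcau r hr)
  -- The value 0 at the origin is a convention here; continuity there is proved only for the
  -- positive minimiser.
  refine ⟨φ, (Ioc 0 R).indicator U, hφ, fun r hr => ?_, by simp⟩
  rw [indicator_of_mem hr]
  exact hU r hr

/-! ### Continuity of mass and logarithmic potential under pointwise convergence -/

section Dominated

variable {ι : Type*} {l : Filter ι} [l.IsCountablyGenerated] {w : ι → ℝ → ℝ} {U : ℝ → ℝ} {K : ℝ}

theorem tendsto_massForm (hw : ∀ i, FiniteEnergy R (w i))
    (hK : ∀ i, ∀ r ∈ Ioc 0 R, r * w i r ^ 2 ≤ K)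
    (hU : ∀ r ∈ Ioc 0 R, Tendsto (fun i => w i r) l (𝓝 (U r))) :
    Tendsto (fun i => massForm R (w i) (w i)) l (𝓝 (massForm R U U)) := by
  refine tendsto_integral_filter_of_dominated_convergence (fun _ => K)
    (Eventually.of_forall fun i => ((hw i).integrableOn_mul (hw i)).aestronglyMeasurable)
    (Eventually.of_forall fun i => ?_) (integrable_const _) ?_
  · filter_upwards [ae_mem_Ioo R] with r hr
    rw [Real.norm_eq_abs, abs_of_nonneg (mul_nonneg hr.1.le (mul_self_nonneg _)), ← pow_two]
    exact hK i r (Ioo_subset_Ioc_self hr)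
  · filter_upwards [ae_mem_Ioo R] with r hr
    have h := hU r (Ioo_subset_Ioc_self hr)
    exact (h.mul h).const_mul r

theorem tendsto_logPotential (hα : 0 < α) (hw : ∀ i, FiniteEnergy R (w i))
    (hK : ∀ i, ∀ r ∈ Ioc 0 R, r * w i r ^ 2 ≤ K)
    (hU : ∀ r ∈ Ioc 0 R, Tendsto (fun i => w i r) l (𝓝 (U r))) :
    Tendsto (fun i => logPotential α R (w i)) l (𝓝 (logPotential α R U)) := by
  refine tendsto_integral_filter_of_dominated_convergence (fun _ => α * K)
    (Eventually.of_forall fun i => ((hw i).integrableOn_log hα).aestronglyMeasurable)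
    (Eventually.of_forall fun i => ?_) (integrable_const _) ?_
  · filter_upwards [ae_mem_Ioo R] with r hr
    rw [Real.norm_eq_abs, abs_of_nonneg (mul_nonneg hr.1.le (log_one_add_mul_sq_nonneg hα _))]
    have h1 := hK i r (Ioo_subset_Ioc_self hr)
    have h2 := mul_le_mul_of_nonneg_left (log_one_add_mul_sq_le hα (w i r)) hr.1.le
    nlinarith
  · filter_upwards [ae_mem_Ioo R] with r hr
    have h := hU r (Ioo_subset_Ioc_self hr)
    have h1 := one_le_one_add_mul_sq hα (U r)
    exact ((((h.pow 2).const_mul α).const_add 1).log (by linarith)).const_mul r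

end Dominated

/-- A function represented by a square integrable derivative has finite energy. -/
theorem finiteEnergy_of_integral (hR : 0 < R) {g U : ℝ → ℝ}
    (hgm : AEStronglyMeasurable g (volume.restrict (Ioo 0 R)))
    (hg : IntegrableOn (fun r => r * g r ^ 2) (Ioo 0 R))
    (hUg : ∀ r ∈ Ioc 0 R, U r = -∫ s in r..R, g s)
    (hU : IntegrableOn (fun r => r⁻¹ * U r ^ 2) (Ioo 0 R)) :
    FiniteEnergy R U ∧ ∀ᵐ r ∂volume.restrict (Ioo 0 R), deriv U r = g r := by
  have hint : ∀ a ∈ Ioc 0 R, IntervalIntegrable g volume a R := fun a ha =>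
    intervalIntegrable_of_weighted hgm hg ha.1 ha.2 le_rfl
  have hUg' : ∀ r ∈ Ioc 0 R, ∫ s in R..r, g s = U r := fun r hr => by
    rw [hUg r hr, intervalIntegral.integral_symm]
  -- Lebesgue differentiation of the primitive of g.
  have hae : ∀ᵐ r ∂volume.restrict (Ioo 0 R), deriv U r = g r := by
    have h1 : ∀ᵐ r ∂volume.restrict (Ioo 0 R), HasDerivAt (fun x => ∫ t in R..x, g t) (g r) r := by
      refine FiniteEnergy.ae_of_forall_Icc fun a ha => ?_
      filter_upwards [(hint a ⟨ha.1, ha.2.le⟩).ae_hasDerivAt_integral] with x hx hxI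
      rw [uIcc_of_le ha.2.le] at hx
      exact hx hxI R ⟨ha.2.le, le_rfl⟩
    filter_upwards [h1, ae_mem_Ioo R] with r h2 hr
    refine (h2.congr_of_eventuallyEq ?_).deriv
    filter_upwards [isOpen_Ioo.mem_nhds hr] with x hx
    exact (hUg' x (Ioo_subset_Ioc_self hx)).symm
  refine ⟨⟨fun a ha => ?_, ?_, ?_, hU⟩, hae⟩
  · refine ((hint a ha).absolutelyContinuousOnInterval_intervalIntegral (c := R) (by simp)).congr
      fun x hx => ?_
    rw [uIcc_of_le ha.2] at hx
    exact hUg' x ⟨ha.1.trans_le hx.1, hx.2⟩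
  · simpa using hUg R ⟨hR, le_rfl⟩
  · refine hg.congr ?_
    filter_upwards [hae] with r hr
    rw [hr]

/-! ### Existence of a minimiser in the energy class -/

/-- `u` minimises the reduced action among all functions of finite energy with the same mass. -/
def IsReducedMinimizer (n : ℤ) (α R : ℝ) (u : ℝ → ℝ) : Prop :=
  FiniteEnergy R u ∧ ∀ v, FiniteEnergy R v → massForm R v v = massForm R u u →
    reducedAction n α R u ≤ reducedAction n α R v

theorem FiniteEnergy.kinForm_self_eq (n : ℤ) (hu : FiniteEnergy R u) :
    kinForm n R u u = (∫ r in Ioo 0 R, r * deriv u r ^ 2)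
      + (n : ℝ) ^ 2 * ∫ r in Ioo 0 R, r⁻¹ * u r ^ 2 := by
  rw [kinForm, integral_add (hu.integrableOn_deriv_mul hu)
    ((hu.integrableOn_inv_mul hu).const_mul _), integral_const_mul]
  simp only [pow_two]

theorem massForm_pos_of_pos (hR : 0 < R) (hu : FiniteEnergy R u) (h : ∀ r ∈ Ioo 0 R, 0 < u r) :
    0 < massForm R u u := by
  rw [massForm, setIntegral_pos_iff_support_of_nonneg_ae]
  · have : (Function.support fun r => r * (u r * u r)) ∩ Ioo 0 R = Ioo 0 R := by
      refine inter_eq_right.2 fun r hr => ?_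
      have h1 := h r hr
      have h2 := hr.1
      simp only [Function.mem_support]
      positivity
    rw [this]
    simpa using hR
  · filter_upwards [ae_Ioo_pos R] with r hr
    exact mul_nonneg hr (mul_self_nonneg _)
  · exact hu.integrableOn_mul hu

/-- The competitor r(R - r), rescaled to the prescribed mass. -/
theorem exists_finiteEnergy_massForm_eq (hR : 0 < R) {q : ℝ} (hq : 0 ≤ q) :
    ∃ u, FiniteEnergy R u ∧ massForm R u u = q := by
  have hd : ∀ r : ℝ, HasDerivAt (fun r => r * (R - r)) (R - 2 * r) r := fun r => by
    have := (hasDerivAt_id r).mul ((hasDerivAt_id r).const_sub R)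
    refine this.congr_deriv ?_
    simp; ring
  have hd' : deriv (fun r => r * (R - r)) = fun r => R - 2 * r := funext fun r => (hd r).deriv
  have hu : FiniteEnergy R (fun r => r * (R - r)) := by
    refine ⟨fun a ha => ?_, by simp, ?_, ?_⟩
    · refine absolutelyContinuousOnInterval_of_deriv ha.2 (by fun_prop)
        (fun x _ => (hd x).differentiableAt) ?_
      rw [hd']
      exact (by fun_prop : Continuous fun r : ℝ => R - 2 * r).intervalIntegrable _ _
    · rw [hd']
      exact ((by fun_prop : Continuous fun r : ℝ => r * (R - 2 * r) ^ 2).integrableOn_Icc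
        (a := 0) (b := R)).mono_set Ioo_subset_Icc_self
    · refine (((by fun_prop : Continuous fun r : ℝ => r * (R - r) ^ 2).integrableOn_Icc
        (a := 0) (b := R)).mono_set Ioo_subset_Icc_self).congr_fun (fun r hr => ?_)
        measurableSet_Ioo
      have := hr.1.ne'
      simp only
      field_simp
  have hm := massForm_pos_of_pos hR hu fun r hr => mul_pos hr.1 (by linarith [hr.2])
  refine ⟨_, hu.const_mul (√(q / massForm R (fun r => r * (R - r)) fun r => r * (R - r))), ?_⟩
  rw [massForm_const_mul, Real.sq_sqrt (by positivity), div_mul_cancel₀ _ hm.ne']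

/-- Scaling u up to mass q multiplies J by at most q / mass, which extends the lower bound ι to
masses below q. -/
theorem mul_massForm_le_mul_reducedAction (hα : 0 < α) {q ι : ℝ} (hq : 0 < q)
    (hι : ∀ v, FiniteEnergy R v → massForm R v v = q → ι ≤ reducedAction n α R v)
    (hu : FiniteEnergy R u) (hle : massForm R u u ≤ q) :
    ι * massForm R u u ≤ q * reducedAction n α R u := by
  rcases (massForm_self_nonneg R u).eq_or_lt with h | h
  · rw [← h, mul_zero]
    exact mul_nonneg hq.le (reducedAction_nonneg n hα R u)
  · have hc : √(q / massForm R u u) ^ 2 = q / massForm R u u := Real.sq_sqrt (by positivity)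
    have h1 := hι _ (hu.const_mul (√(q / massForm R u u)))
      (by rw [massForm_const_mul, hc, div_mul_cancel₀ _ h.ne'])
    have h2 := hu.reducedAction_const_mul_le (n := n) hα (c := √(q / massForm R u u))
      (by rw [hc, le_div_iff₀ h]; linarith)
    rw [hc, div_mul_eq_mul_div] at h2
    exact (le_div_iff₀ h).1 (h1.trans h2)

theorem exists_isReducedMinimizer (hn : n ≠ 0) (hα : 0 < α) (hR : 0 < R) {q : ℝ} (hq : 0 < q) :
    ∃ u, IsReducedMinimizer n α R u ∧ massForm R u u = q ∧ u 0 = 0 := by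
  have hn2 : (0 : ℝ) < (n : ℝ) ^ 2 := by positivity
  set S : Set ℝ := {x | ∃ v, FiniteEnergy R v ∧ massForm R v v = q ∧ reducedAction n α R v = x}
    with hS
  have hSne : S.Nonempty := by
    obtain ⟨v, hv, hvq⟩ := exists_finiteEnergy_massForm_eq hR hq.le
    exact ⟨_, v, hv, hvq, rfl⟩
  have hSbdd : BddBelow S := ⟨0, by
    rintro x ⟨v, -, -, rfl⟩; exact reducedAction_nonneg n hα R v⟩
  set ι := sInf S with hι
  have hιle : ∀ v, FiniteEnergy R v → massForm R v v = q → ι ≤ reducedAction n α R v :=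
    fun v hv hvq => csInf_le hSbdd ⟨v, hv, hvq, rfl⟩
  obtain ⟨x, hxa, hxt, hxS⟩ := exists_seq_tendsto_sInf hSne hSbdd
  choose y hyF hyq hyx using hxS
  have hdir : ∀ w, FiniteEnergy R w → ∫ r in Ioo 0 R, r * deriv w r ^ 2 ≤ kinForm n R w w := by
    intro w hw
    refine integral_mono_ae hw.integrableOn_deriv (hw.integrableOn_kin hw n) ?_
    filter_upwards [ae_Ioo_inv_pos R] with r hr
    have h1 : 0 ≤ (n : ℝ) ^ 2 * (r⁻¹ * (w r * w r)) :=
      mul_nonneg hn2.le (mul_nonneg hr (mul_self_nonneg _))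
    linarith
  have hkin : ∀ w, kinForm n R w w ≤ 2 * reducedAction n α R w := by
    intro w
    have := mul_nonneg (sq_nonneg α⁻¹) (logPotential_nonneg hα R w)
    rw [reducedAction]; linarith
  -- The minimising values are antitone, so J ≤ x 0 along the sequence and the Dirichlet integrals
  -- are at most 2 x 0.
  obtain ⟨φ, U, hφ, hU, hU0⟩ := exists_pointwise_limit (K := 2 * x 0) hyF fun k =>
    (hdir _ (hyF k)).trans ((hkin _).trans (by rw [hyx]; linarith [hxa (Nat.zero_le k)]))
  set w : ℕ → ℝ → ℝ := fun k => y (φ k) with hw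
  have hwF : ∀ k, FiniteEnergy R (w k) := fun k => hyF _
  have hwq : ∀ k, massForm R (w k) (w k) = q := fun k => hyq _
  have hwt : Tendsto (fun k => reducedAction n α R (w k)) atTop (𝓝 ι) := by
    simp only [hw, hyx]
    exact hxt.comp hφ.tendsto_atTop
  have hwK : ∀ k, ∀ r ∈ Ioc 0 R, r * w k r ^ 2 ≤ R * (2 * x 0) := fun k r hr =>
    ((hwF k).sq_le hr).trans (mul_le_mul_of_nonneg_left ((hdir _ (hwF k)).trans ((hkin _).trans
      (by simp only [hw, hyx]; linarith [hxa (Nat.zero_le (φ k))]))) hR.le)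
  have hUq : massForm R U U = q :=
    tendsto_nhds_unique (tendsto_massForm hwF hwK hU) (by simp [hwq])
  have hlog := tendsto_logPotential hα hwF hwK hU
  set c := 2 * (ι - (α⁻¹) ^ 2 * logPotential α R U) with hc
  have hkt : Tendsto (fun k => kinForm n R (w k) (w k)) atTop (𝓝 c) := by
    refine ((hwt.sub (hlog.const_mul ((α⁻¹) ^ 2))).const_mul 2).congr fun k => ?_
    rw [reducedAction]; ring
  -- The midpoints converge as well, so the parallelogram identity applies.
  set m : ℕ × ℕ → ℝ → ℝ := fun p r => (1 / 2) * (w p.1 r + 1 * w p.2 r) with hm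
  have hmF : ∀ p, FiniteEnergy R (m p) := fun p => ((hwF p.1).add_mul (hwF p.2) 1).const_mul _
  have hfst : Tendsto (Prod.fst : ℕ × ℕ → ℕ) atTop atTop := by
    rw [← prod_atTop_atTop_eq]; exact tendsto_fst
  have hsnd : Tendsto (Prod.snd : ℕ × ℕ → ℕ) atTop atTop := by
    rw [← prod_atTop_atTop_eq]; exact tendsto_snd
  have hmU : ∀ r ∈ Ioc 0 R, Tendsto (fun p => m p r) atTop (𝓝 (U r)) := by
    intro r hr
    have h := (((hU r hr).comp hfst).add (((hU r hr).comp hsnd).const_mul 1)).const_mul (1 / 2)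
    have e : (1 / 2) * (U r + 1 * U r) = U r := by ring
    rw [e] at h
    exact h
  have hmK : ∀ p, ∀ r ∈ Ioc 0 R, r * m p r ^ 2 ≤ R * (2 * x 0) := by
    intro p r hr
    have h1 := hwK p.1 r hr
    have h2 := hwK p.2 r hr
    have h3 : m p r ^ 2 ≤ (w p.1 r ^ 2 + w p.2 r ^ 2) / 2 := by
      simp only [hm]; nlinarith [sq_nonneg (w p.1 r - w p.2 r)]
    nlinarith [mul_le_mul_of_nonneg_left h3 hr.1.le]
  have hmmass := tendsto_massForm hmF hmK hmU
  have hmlog := tendsto_logPotential hα hmF hmK hmU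
  rw [hUq] at hmmass
  have hpar : ∀ p : ℕ × ℕ, kinForm n R (fun r => w p.1 r + (-1) * w p.2 r)
      (fun r => w p.1 r + (-1) * w p.2 r) = 2 * kinForm n R (w p.1) (w p.1)
        + 2 * kinForm n R (w p.2) (w p.2) - 4 * kinForm n R (m p) (m p) := by
    intro p
    rw [hm, kinForm_const_mul, (hwF p.1).kinForm_add_mul (hwF p.2),
      (hwF p.1).kinForm_add_mul (hwF p.2)]
    ring
  have hmle : ∀ p, massForm R (m p) (m p) ≤ q := by
    intro p
    have h1 := (hwF p.1).massForm_add_mul (hwF p.2) 1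
    have h2 := (hwF p.1).massForm_add_mul (hwF p.2) (-1)
    have h3 := massForm_self_nonneg R (fun r => w p.1 r + (-1) * w p.2 r)
    rw [hm, massForm_const_mul, h1, hwq, hwq]
    rw [h2, hwq, hwq] at h3
    linarith
  -- In the parallelogram identity the midpoint's kinetic energy is bounded below through J(m) ≥ ι ·
  -- mass(m)/q; the right-hand side then tends to 2c + 2c - 4c = 0.
  have hdiff : ∀ p : ℕ × ℕ, ∫ r in Ioo 0 R, r * (deriv (w p.1) r - deriv (w p.2) r) ^ 2
      ≤ 2 * kinForm n R (w p.1) (w p.1) + 2 * kinForm n R (w p.2) (w p.2)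
        - 8 * (ι * massForm R (m p) (m p) / q - (α⁻¹) ^ 2 * logPotential α R (m p)) := by
    intro p
    have h1 := mul_massForm_le_mul_reducedAction (n := n) hα hq hιle (hmF p) (hmle p)
    have h2 : ι * massForm R (m p) (m p) / q ≤ reducedAction n α R (m p) := by
      rw [div_le_iff₀ hq]; linarith
    have h3 := hdir _ ((hwF p.1).add_mul (hwF p.2) (-1))
    have h4 : ∫ r in Ioo 0 R, r * (deriv (w p.1) r - deriv (w p.2) r) ^ 2
        = ∫ r in Ioo 0 R, r * deriv (fun r => w p.1 r + (-1) * w p.2 r) r ^ 2 := by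
      refine integral_congr_ae ?_
      filter_upwards [(hwF p.1).ae_deriv_add_mul (hwF p.2) (-1)] with r hr
      rw [hr]; ring
    rw [hpar, ← h4] at h3
    rw [reducedAction] at h2
    linarith
  have hcau : Tendsto (fun p : ℕ × ℕ =>
      ∫ r in Ioo 0 R, r * (deriv (w p.1) r - deriv (w p.2) r) ^ 2) atTop (𝓝 0) := by
    refine tendsto_of_tendsto_of_tendsto_of_le_of_le tendsto_const_nhds ?_ (fun p => ?_) hdiff
    · have h := ((((hkt.comp hfst).const_mul 2).add ((hkt.comp hsnd).const_mul 2)).sub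
        ((((hmmass.const_mul ι).div_const q).sub (hmlog.const_mul ((α⁻¹) ^ 2))).const_mul 8))
      have e : 2 * c + 2 * c - 8 * (ι * q / q - (α⁻¹) ^ 2 * logPotential α R U) = 0 := by
        rw [mul_div_cancel_right₀ _ hq.ne', hc]; ring
      rw [e] at h
      exact h
    · exact integral_nonneg_of_ae ((ae_Ioo_pos R).mono fun r hr => mul_nonneg hr (sq_nonneg _))
  obtain ⟨g, hgm, hg, hgd, hgn⟩ := exists_weighted_limit
    (fun k => FiniteEnergy.aestronglyMeasurable_deriv (w k) R)
    (fun k => (hwF k).integrableOn_deriv) hcau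
  -- The Morrey estimate for w_k' - g identifies the pointwise limit U with the primitive of the L²
  -- limit g.
  have hUg : ∀ r ∈ Ioc 0 R, U r = -∫ s in r..R, g s := by
    intro r hr
    have hdm : ∀ k, AEStronglyMeasurable (fun s => deriv (w k) s - g s)
        (volume.restrict (Ioo 0 R)) := fun k =>
      (FiniteEnergy.aestronglyMeasurable_deriv (w k) R).sub hgm
    have hdi : ∀ k, IntegrableOn (fun s => s * (deriv (w k) s - g s) ^ 2) (Ioo 0 R) := by
      intro k
      have h1 := integrable_weight_mul (ae_Ioo_pos R) (FiniteEnergy.aesm_id R)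
        (FiniteEnergy.aestronglyMeasurable_deriv (w k) R) hgm (hwF k).integrableOn_deriv hg
      refine (((hwF k).integrableOn_deriv.sub (h1.const_mul 2)).add hg).congr
        (Eventually.of_forall fun s => ?_)
      simp only [Pi.add_apply, Pi.sub_apply]
      ring
    have h1 : ∀ k, (-w k r - ∫ s in r..R, g s) ^ 2
        ≤ (R - r) / r * ∫ s in Ioo 0 R, s * (deriv (w k) s - g s) ^ 2 := by
      intro k
      have h2 := sq_intervalIntegral_le (hdm k) (hdi k) hr.1 hr.2 le_rfl
      rw [intervalIntegral.integral_sub ((hwF k).intervalIntegrable_deriv hr.1 hr.2 le_rfl)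
        (intervalIntegrable_of_weighted hgm hg hr.1 hr.2 le_rfl),
        (hwF k).integral_deriv hr.1 hr.2 le_rfl, (hwF k).right_boundary, zero_sub] at h2
      exact h2
    have h2 : Tendsto (fun k => (-w k r - ∫ s in r..R, g s) ^ 2) atTop
        (𝓝 ((-U r - ∫ s in r..R, g s) ^ 2)) := ((hU r hr).neg.sub_const _).pow 2
    have h3 : (-U r - ∫ s in r..R, g s) ^ 2 ≤ (R - r) / r * 0 :=
      le_of_tendsto_of_tendsto' h2 (hgd.const_mul _) h1
    have h4 : (-U r - ∫ s in r..R, g s) = 0 := by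
      refine pow_eq_zero_iff two_ne_zero |>.1 (le_antisymm (by simpa using h3) (sq_nonneg _))
    linarith
  -- The derivative part converges strongly, so Fatou is needed only for u²/r, whose integrals
  -- converge because n ≠ 0.
  have hfat := integrable_of_tendsto_of_integral_tendsto
    (μ := volume.restrict (Ioo 0 R)) (f := fun k r => r⁻¹ * w k r ^ 2) (g := fun r => r⁻¹ * U r ^ 2)
    (c := (c - ∫ r in Ioo 0 R, r * g r ^ 2) / (n : ℝ) ^ 2)
    (fun k => (hwF k).integrableOn_inv)
    (fun k => (ae_Ioo_inv_pos R).mono fun r hr => mul_nonneg hr (sq_nonneg _))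
    ((ae_mem_Ioo R).mono fun r hr => ((hU r (Ioo_subset_Ioc_self hr)).pow 2).const_mul _)
    (((hkt.sub hgn).div_const _).congr fun k => by
      rw [(hwF k).kinForm_self_eq n]; field_simp; ring)
  obtain ⟨hUF, hUd⟩ := finiteEnergy_of_integral hR hgm hg hUg hfat.1
  have hUkin : kinForm n R U U ≤ c := by
    have h1 : ∫ r in Ioo 0 R, r * deriv U r ^ 2 = ∫ r in Ioo 0 R, r * g r ^ 2 := by
      refine integral_congr_ae ?_
      filter_upwards [hUd] with r hr
      rw [hr]
    have h2 := (le_div_iff₀ hn2).1 hfat.2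
    rw [hUF.kinForm_self_eq n, h1]
    linarith
  refine ⟨U, ⟨hUF, fun v hv hvq => ?_⟩, hUq, hU0⟩
  refine le_trans ?_ (hιle v hv (hvq.trans hUq))
  rw [reducedAction]
  linarith

/-- Scaling v down to the mass of u does not raise J, so the constraint may be relaxed to an
inequality. -/
theorem IsReducedMinimizer.le_of_massForm_le (hα : 0 < α) (hu : IsReducedMinimizer n α R u)
    (h0 : 0 < massForm R u u) (hv : FiniteEnergy R v) (h : massForm R u u ≤ massForm R v v) :
    reducedAction n α R u ≤ reducedAction n α R v := by
  have hv0 := h0.trans_le h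
  have hc : √(massForm R u u / massForm R v v) ^ 2 = massForm R u u / massForm R v v :=
    Real.sq_sqrt (by positivity)
  refine (hu.2 _ (hv.const_mul (√(massForm R u u / massForm R v v))) ?_).trans
    (hv.reducedAction_const_mul_le_of_le_one hα ?_)
  · rw [massForm_const_mul, hc, div_mul_cancel₀ _ hv0.ne']
  · rw [hc, div_le_one hv0]; exact h

theorem IsReducedMinimizer.abs (hu : IsReducedMinimizer n α R u) :
    IsReducedMinimizer n α R (fun r => |u r|) := by
  refine ⟨hu.1.abs.1, fun v hv h => hu.1.reducedAction_abs_le.trans (hu.2 v hv ?_)⟩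
  rw [h, massForm_abs]

/-- The weak form of the Euler-Lagrange equation. -/
theorem IsReducedMinimizer.exists_multiplier (hα : 0 < α) (hu : IsReducedMinimizer n α R u)
    (h0 : 0 < massForm R u u) :
    ∃ μ : ℝ, ∀ v, FiniteEnergy R v →
      kinForm n R u v + (α⁻¹) ^ 2 * logForm α R u v + μ * massForm R u v = 0 := by
  -- For v orthogonal to u the mass of u + t v is at least that of u, so t = 0 minimises J(u + t v)
  -- over all real t.
  have horth : ∀ v, FiniteEnergy R v → massForm R u v = 0 →
      kinForm n R u v + (α⁻¹) ^ 2 * logForm α R u v = 0 := by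
    intro v hv hm
    refine IsLocalMin.hasDerivAt_eq_zero (a := 0) (Eventually.of_forall fun t => ?_)
      (hu.1.hasDerivAt_reducedAction n hα hv)
    have h1 := hu.le_of_massForm_le hα h0 (hu.1.add_mul hv t) (by
      rw [hu.1.massForm_add_mul hv, hm]
      nlinarith [mul_nonneg (sq_nonneg t) (massForm_self_nonneg R v)])
    simpa using h1
  -- Testing with v = u dictates this value; a general v is reduced to the orthogonal case by
  -- subtracting its component along u.
  refine ⟨-(kinForm n R u u + (α⁻¹) ^ 2 * logForm α R u u) / massForm R u u, fun v hv => ?_⟩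
  have h1 := horth _ (hv.add_mul hu.1 (-(massForm R u v / massForm R u u))) (by
    rw [hu.1.massForm_add_mul_right hv hu.1]
    field_simp; ring)
  rw [hu.1.kinForm_add_mul_right hv hu.1, hu.1.logForm_add_mul_right hα hv hu.1] at h1
  rw [← h1]
  field_simp; ring

/-! ### Regularity of weak solutions -/

/-- The du Bois-Reymond lemma on a compact subinterval: weak solutions of `(r u')' = F` satisfy
`r u' = ∫ F + const`. -/
theorem exists_ae_eq_of_weak {F : ℝ → ℝ} (hF : ContinuousOn F (Ioo 0 R)) (hu : FiniteEnergy R u)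
    (hweak : ∀ v, FiniteEnergy R v →
      (∫ r in Ioo 0 R, r * (deriv u r * deriv v r)) + ∫ r in Ioo 0 R, F r * v r = 0)
    {a b : ℝ} (ha : 0 < a) (hab : a < b) (hb : b < R) :
    ∃ c : ℝ, ∀ᵐ r ∂volume.restrict (Ioo a b), r * deriv u r = (∫ s in a..r, F s) + c := by
  have hR : 0 < R := ha.trans (hab.trans hb)
  have hsub : Icc a b ⊆ Ioo 0 R := fun x hx => ⟨ha.trans_le hx.1, hx.2.trans_lt hb⟩
  have hsubo : Ioo a b ⊆ Ioo 0 R := Ioo_subset_Icc_self.trans hsub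
  have hFc : ContinuousOn F (uIcc a b) := by rw [uIcc_of_le hab.le]; exact hF.mono hsub
  have hFi : IntervalIntegrable F volume a b := hFc.intervalIntegrable
  set Φ : ℝ → ℝ := fun r => ∫ s in a..r, F s with hΦ
  have hΦac : AbsolutelyContinuousOnInterval Φ a b :=
    hFi.absolutelyContinuousOnInterval_intervalIntegral (by simp)
  have hΦc : ContinuousOn Φ (Icc a b) := by
    simpa [uIcc_of_le hab.le] using hΦac.continuousOn
  have hΦd : ∀ r ∈ Ioo a b, HasDerivAt Φ (F r) r := fun r hr =>
    intervalIntegral.integral_hasDerivAt_right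
      (hFi.mono_set (by
        rw [uIcc_of_le hr.1.le, uIcc_of_le hab.le]; exact Icc_subset_Icc_right hr.2.le))
      (hF.stronglyMeasurableAtFilter isOpen_Ioo r (hsubo hr))
      (hF.continuousAt (isOpen_Ioo.mem_nhds (hsubo hr)))
  set k : ℝ → ℝ := fun r => r * deriv u r - Φ r with hk
  have hui : IntervalIntegrable (deriv u) volume a b :=
    hu.intervalIntegrable_deriv ha hab.le hb.le
  have hki' : IntervalIntegrable k volume a b :=
    (hui.continuousOn_mul continuousOn_id).sub hΦac.continuousOn.intervalIntegrable
  have hki : IntegrableOn k (Ioo a b) :=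
    (intervalIntegrable_iff_integrableOn_Ioo_of_le hab.le).1 hki'
  -- The mean of k = r u' - Φ. The test function v will have v' = k - c on (a, b); zero mean makes v
  -- vanish outside, and the weak equation becomes ∫ (k - c)² = 0.
  set c : ℝ := (∫ r in Ioo a b, k r) / (b - a) with hc
  have hbig : IntegrableOn (fun r => (k r - c) ^ 2) (Ioo a b) := by
    have h1 : IntegrableOn (fun r => (r * deriv u r) ^ 2) (Ioo a b) := by
      have h2 := ((hu.integrableOn_deriv.mono_set hsubo).const_mul R)
      refine h2.mono' ((measurable_id.mul (measurable_deriv u)).pow_const 2).aestronglyMeasurable ?_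
      filter_upwards [ae_restrict_mem measurableSet_Ioo] with r hr
      have h0 := (hsubo hr).1
      rw [Real.norm_eq_abs, abs_of_nonneg (sq_nonneg _)]
      nlinarith [mul_nonneg h0.le (sq_nonneg (deriv u r)), (hsubo hr).2]
    have h2 : IntegrableOn (fun r => (Φ r + c) ^ 2) (Ioo a b) :=
      (((hΦc.add continuousOn_const).pow 2).integrableOn_Icc).mono_set Ioo_subset_Icc_self
    refine ((h1.add h2).const_mul 2).mono'
      ((hki.aestronglyMeasurable.sub aestronglyMeasurable_const).pow 2) ?_
    refine Eventually.of_forall fun r => ?_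
    simp only [Pi.add_apply, hk, Real.norm_eq_abs]
    rw [abs_of_nonneg (sq_nonneg _)]
    nlinarith [sq_nonneg (r * deriv u r + (Φ r + c))]
  set h : ℝ → ℝ := (Ioo a b).indicator fun r => k r - c with hh
  have hhi : Integrable h :=
    (integrable_indicator_iff measurableSet_Ioo).2 (hki.sub (integrable_const c))
  have hmean : ∫ r in a..b, h r = 0 := by
    rw [intervalIntegral.integral_of_le hab.le, integral_Ioc_eq_integral_Ioo,
      setIntegral_indicator measurableSet_Ioo, inter_self, integral_sub hki (integrable_const c)]
    have : (b - a) ≠ 0 := by linarith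
    simp [hab.le, hc]
    field_simp
    ring
  set v : ℝ → ℝ := fun r => -∫ s in r..R, h s with hv
  have hvc : Continuous v := by
    have : v = fun r => ∫ s in R..r, h s := by
      funext r
      exact (intervalIntegral.integral_symm r R).symm
    rw [this]
    exact intervalIntegral.continuous_primitive (fun _ _ => hhi.intervalIntegrable) R
  have hint0 : ∀ x y, (x ≤ y) → (y ≤ a ∨ b ≤ x) → ∫ s in x..y, h s = 0 := by
    intro x y hxy hor
    rw [intervalIntegral.integral_of_le hxy, integral_Ioc_eq_integral_Ioo]
    refine setIntegral_eq_zero_of_forall_eq_zero fun s hs => indicator_of_notMem (fun hs' => ?_) _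
    rcases hor with h1 | h1
    · linarith [hs.2, hs'.1]
    · linarith [hs.1, hs'.2]
  have hvb : ∀ r, b ≤ r → r ≤ R → v r = 0 := fun r h1 h2 => by
    simp only [hv]; rw [hint0 r R h2 (Or.inr h1), neg_zero]
  have hva : ∀ r, r ≤ a → v r = 0 := fun r h1 => by
    have e1 := intervalIntegral.integral_add_adjacent_intervals
      (hhi.intervalIntegrable (a := r) (b := a)) (hhi.intervalIntegrable (a := a) (b := b))
    have e2 := intervalIntegral.integral_add_adjacent_intervals
      (hhi.intervalIntegrable (a := r) (b := b)) (hhi.intervalIntegrable (a := b) (b := R))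
    simp only [hv]
    rw [← e2, ← e1, hmean, hint0 r a h1 (Or.inl le_rfl), hint0 b R hb.le (Or.inr le_rfl)]
    simp
  obtain ⟨hvF, hvd⟩ := finiteEnergy_of_integral (U := v) hR hhi.aestronglyMeasurable.restrict
    (g := h) (by
      have h1 : IntegrableOn (fun r => R * (k r - c) ^ 2) (Ioo a b) := hbig.const_mul R
      have h2 : Integrable ((Ioo a b).indicator fun r => R * (k r - c) ^ 2) :=
        (integrable_indicator_iff measurableSet_Ioo).2 h1
      refine h2.integrableOn.mono' ((FiniteEnergy.aesm_id R).mul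
        (hhi.aestronglyMeasurable.restrict.pow 2)) ?_
      filter_upwards [ae_mem_Ioo R] with r hr
      rw [Real.norm_eq_abs, abs_of_nonneg (mul_nonneg hr.1.le (sq_nonneg _))]
      by_cases hrI : r ∈ Ioo a b
      · rw [hh, indicator_of_mem hrI, indicator_of_mem hrI]
        exact mul_le_mul_of_nonneg_right hr.2.le (sq_nonneg _)
      · rw [hh, indicator_of_notMem hrI, indicator_of_notMem hrI]; simp)
    -- Since v = 0 for r ≤ a, the singular weight 1/r is at most 1/a wherever it matters.
    (fun r _ => rfl) (by
      have h1 : IntegrableOn (fun r => a⁻¹ * v r ^ 2) (Ioo 0 R) :=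
        (by fun_prop : Continuous fun r => a⁻¹ * v r ^ 2).integrableOn_Icc.mono_set
          Ioo_subset_Icc_self
      refine h1.mono' ((FiniteEnergy.aesm_inv R).mul (hvc.aestronglyMeasurable.pow 2)) ?_
      filter_upwards [ae_mem_Ioo R] with r hr
      rw [Real.norm_eq_abs, abs_of_nonneg (mul_nonneg (inv_pos.2 hr.1).le (sq_nonneg _))]
      rcases le_or_gt r a with h2 | h2
      · rw [hva r h2]; simp
      · exact mul_le_mul_of_nonneg_right (inv_anti₀ ha h2.le) (sq_nonneg _))
  have hw := hweak v hvF
  have hw1 : ∫ r in Ioo 0 R, r * (deriv u r * deriv v r) = ∫ r in Ioo a b, r * deriv u r * h r := by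
    have e1 : ∫ r in Ioo 0 R, r * (deriv u r * deriv v r)
        = ∫ r in Ioo 0 R, (Ioo a b).indicator (fun r => r * deriv u r * (k r - c)) r := by
      refine integral_congr_ae ?_
      filter_upwards [hvd] with r hr
      rw [hr, hh]
      by_cases hrI : r ∈ Ioo a b
      · rw [indicator_of_mem hrI, indicator_of_mem hrI]; ring
      · rw [indicator_of_notMem hrI, indicator_of_notMem hrI]; ring
    rw [e1, setIntegral_indicator measurableSet_Ioo, inter_eq_right.2 hsubo]
    refine setIntegral_congr_fun measurableSet_Ioo fun r hr => ?_
    simp only [hh]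
    rw [indicator_of_mem hr]
  have hw2 : ∫ r in Ioo 0 R, F r * v r = ∫ r in a..b, v r * deriv Φ r := by
    rw [intervalIntegral.integral_of_le hab.le, integral_Ioc_eq_integral_Ioo]
    rw [setIntegral_eq_of_subset_of_forall_sdiff_eq_zero measurableSet_Ioo hsubo]
    · refine setIntegral_congr_fun measurableSet_Ioo fun r hr => ?_
      rw [(hΦd r hr).deriv, mul_comm]
    · intro r hr
      have : r ≤ a ∨ b ≤ r := by
        by_contra hcon
        push Not at hcon
        exact hr.2 ⟨hcon.1, hcon.2⟩
      rcases this with h1 | h1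
      · rw [hva r h1, mul_zero]
      · rw [hvb r h1 hr.1.2.le, mul_zero]
  have hw3 : ∫ r in a..b, v r * deriv Φ r = - ∫ r in Ioo a b, Φ r * h r := by
    rw [(hvF.ac_Icc ha hab.le hb.le).integral_mul_deriv_eq_deriv_mul hΦac, hva a le_rfl,
      hvb b le_rfl hb.le, intervalIntegral.integral_of_le hab.le, integral_Ioc_eq_integral_Ioo]
    have : ∫ r in Ioo a b, deriv v r * Φ r = ∫ r in Ioo a b, Φ r * h r := by
      refine integral_congr_ae ?_
      filter_upwards [ae_restrict_of_ae_restrict_of_subset hsubo hvd] with r hr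
      rw [hr, mul_comm]
    rw [this]; ring
  have hki2 : IntegrableOn (fun r => c * (k r - c)) (Ioo a b) :=
    (hki.sub (integrable_const c)).const_mul c
  have hΦh : IntegrableOn (fun r => Φ r * h r) (Ioo a b) :=
    (intervalIntegrable_iff_integrableOn_Ioo_of_le hab.le).1
      (hhi.intervalIntegrable.continuousOn_mul hΦac.continuousOn)
  have hsq : ∫ r in Ioo a b, (k r - c) ^ 2 = 0 := by
    have hz : ∫ r in Ioo a b, c * (k r - c) = 0 := by
      rw [integral_const_mul]
      rw [intervalIntegral.integral_of_le hab.le, integral_Ioc_eq_integral_Ioo] at hmean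
      have : ∫ r in Ioo a b, (k r - c) = ∫ r in Ioo a b, h r :=
        setIntegral_congr_fun measurableSet_Ioo fun r hr => by
          simp only [hh]; rw [indicator_of_mem hr]
      rw [this, hmean, mul_zero]
    have e1 : ∫ r in Ioo a b, r * deriv u r * h r
        = ∫ r in Ioo a b, (((k r - c) ^ 2 + c * (k r - c)) + Φ r * h r) := by
      refine setIntegral_congr_fun measurableSet_Ioo fun r hr => ?_
      simp only [hh]
      rw [indicator_of_mem hr, hk]
      ring
    have hi3 : IntegrableOn (fun r => (k r - c) ^ 2 + c * (k r - c)) (Ioo a b) := hbig.add hki2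
    rw [integral_add hi3 hΦh, integral_add hbig hki2, hz] at e1
    rw [hw1, hw2, hw3] at hw
    linarith
  have hae := (setIntegral_eq_zero_iff_of_nonneg_ae
    (Eventually.of_forall fun r => sq_nonneg (k r - c)) hbig).1 hsq
  refine ⟨c, ?_⟩
  filter_upwards [hae] with r hr
  have h1 : k r - c = 0 := pow_eq_zero_iff two_ne_zero |>.1 hr
  simp only [hk] at h1
  linarith

/-- By du Bois-Reymond u' agrees almost everywhere with the continuous function (Φ + c)/r. As u is
the integral of u', the agreement holds everywhere inside (a, b), and r u' = Φ + c is
differentiable. -/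
theorem hasDerivAt_of_weak {F : ℝ → ℝ} (hF : ContinuousOn F (Ioo 0 R)) (hu : FiniteEnergy R u)
    (hweak : ∀ v, FiniteEnergy R v →
      (∫ r in Ioo 0 R, r * (deriv u r * deriv v r)) + ∫ r in Ioo 0 R, F r * v r = 0)
    {x : ℝ} (hx : x ∈ Ioo 0 R) :
    DifferentiableAt ℝ u x ∧ HasDerivAt (fun s => s * deriv u s) (F x) x := by
  obtain ⟨a, ha, hax⟩ := exists_between hx.1
  obtain ⟨b, hxb, hb⟩ := exists_between hx.2
  have hab := hax.trans hxb
  obtain ⟨c, hc⟩ := exists_ae_eq_of_weak hF hu hweak ha hab hb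
  have hsub : Icc a b ⊆ Ioo 0 R := fun y hy => ⟨ha.trans_le hy.1, hy.2.trans_lt hb⟩
  have hFi : IntervalIntegrable F volume a b :=
    ContinuousOn.intervalIntegrable (by rw [uIcc_of_le hab.le]; exact hF.mono hsub)
  set Φ : ℝ → ℝ := fun r => ∫ s in a..r, F s with hΦ
  have hΦc : ContinuousOn Φ (Icc a b) := by
    simpa [uIcc_of_le hab.le] using
      (hFi.absolutelyContinuousOnInterval_intervalIntegral (c := a) (by simp)).continuousOn
  have hΦd : ∀ r ∈ Ioo a b, HasDerivAt Φ (F r) r := fun r hr =>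
    intervalIntegral.integral_hasDerivAt_right
      (hFi.mono_set (by
        rw [uIcc_of_le hr.1.le, uIcc_of_le hab.le]; exact Icc_subset_Icc_right hr.2.le))
      (hF.stronglyMeasurableAtFilter isOpen_Ioo r (hsub (Ioo_subset_Icc_self hr)))
      (hF.continuousAt (isOpen_Ioo.mem_nhds (hsub (Ioo_subset_Icc_self hr))))
  set G : ℝ → ℝ := fun r => (Φ r + c) / r with hG
  have hGc : ContinuousOn G (Icc a b) :=
    (hΦc.add continuousOn_const).div continuousOn_id fun y hy => (hsub hy).1.ne'
  have hGi : IntervalIntegrable G volume a b :=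
    ContinuousOn.intervalIntegrable (by rwa [uIcc_of_le hab.le])
  have hu_eq : ∀ y ∈ Icc a b, u y = u a + ∫ s in a..y, G s := by
    intro y hy
    have h1 := hu.integral_deriv ha hy.1 (hy.2.trans hb.le)
    have h2 : ∫ s in a..y, deriv u s = ∫ s in a..y, G s := by
      rw [intervalIntegral.integral_of_le hy.1, intervalIntegral.integral_of_le hy.1,
        integral_Ioc_eq_integral_Ioo, integral_Ioc_eq_integral_Ioo]
      refine integral_congr_ae ?_
      filter_upwards [ae_restrict_of_ae_restrict_of_subset (Ioo_subset_Ioo_right hy.2) hc,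
        ae_restrict_mem measurableSet_Ioo] with r hr hrI
      have h0 : 0 < r := ha.trans hrI.1
      rw [hG]; simp only
      rw [eq_div_iff h0.ne', mul_comm]
      exact hr
    linarith
  have hud : ∀ r ∈ Ioo a b, HasDerivAt u (G r) r := by
    intro r hr
    have h1 := (intervalIntegral.integral_hasDerivAt_right
      (hGi.mono_set (by
        rw [uIcc_of_le hr.1.le, uIcc_of_le hab.le]; exact Icc_subset_Icc_right hr.2.le))
      ((hGc.mono Ioo_subset_Icc_self).stronglyMeasurableAtFilter isOpen_Ioo r hr)
      ((hGc.mono Ioo_subset_Icc_self).continuousAt (isOpen_Ioo.mem_nhds hr))).const_add (u a)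
    refine h1.congr_of_eventuallyEq ?_
    filter_upwards [isOpen_Ioo.mem_nhds hr] with y hy
    exact hu_eq y (Ioo_subset_Icc_self hy)
  refine ⟨(hud x ⟨hax, hxb⟩).differentiableAt, ?_⟩
  refine ((hΦd x ⟨hax, hxb⟩).add_const c).congr_of_eventuallyEq ?_
  filter_upwards [isOpen_Ioo.mem_nhds (⟨hax, hxb⟩ : x ∈ Ioo a b)] with y hy
  rw [(hud y hy).deriv, hG]
  have : y ≠ 0 := (ha.trans hy.1).ne'
  simp only
  field_simp

theorem contDiffOn_two_of_hasDerivAt {F : ℝ → ℝ} (hF : ContinuousOn F (Ioo 0 R))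
    (h1 : ∀ x ∈ Ioo 0 R, DifferentiableAt ℝ u x)
    (h2 : ∀ x ∈ Ioo 0 R, HasDerivAt (fun s => s * deriv u s) (F x) x) :
    ContDiffOn ℝ 2 u (Ioo 0 R) := by
  have hp : ContDiffOn ℝ 1 (fun s => s * deriv u s) (Ioo 0 R) := by
    refine (contDiffOn_succ_iff_deriv_of_isOpen (n := 0) isOpen_Ioo).2
      ⟨fun x hx => (h2 x hx).differentiableAt.differentiableWithinAt, by simp, ?_⟩
    rw [contDiffOn_zero]
    exact hF.congr fun x hx => (h2 x hx).deriv
  refine (contDiffOn_succ_iff_deriv_of_isOpen (n := 1) isOpen_Ioo).2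
    ⟨fun x hx => (h1 x hx).differentiableWithinAt, by simp, ?_⟩
  refine (hp.div contDiffOn_id fun x hx => hx.1.ne').congr fun x hx => ?_
  have : x ≠ 0 := hx.1.ne'
  simp only [Pi.div_apply, id]
  field_simp

/-! ### Positivity -/

/-- An interior zero of u ≥ 0 is a minimum, so u' vanishes there too, and uniqueness for the linear
equation forces u to vanish identically. -/
theorem eq_zero_of_touching {C : ℝ → ℝ} (hC : ContinuousOn C (Ioo 0 R))
    (h1 : ∀ x ∈ Ioo 0 R, DifferentiableAt ℝ u x)
    (h2 : ∀ x ∈ Ioo 0 R, HasDerivAt (fun s => s * deriv u s) (C x * u x) x)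
    (h0 : ∀ x ∈ Ioo 0 R, 0 ≤ u x) {x₀ : ℝ} (hx₀ : x₀ ∈ Ioo 0 R) (hz : u x₀ = 0) :
    ∀ x ∈ Ioo 0 R, u x = 0 := by
  intro x hx
  have hd : deriv u x₀ = 0 := by
    refine IsLocalMin.deriv_eq_zero ?_
    filter_upwards [isOpen_Ioo.mem_nhds hx₀] with y hy
    rw [hz]; exact h0 y hy
  obtain ⟨a, ha, ham⟩ := exists_between (lt_min hx.1 hx₀.1)
  obtain ⟨b, hbm, hb⟩ := exists_between (max_lt hx.2 hx₀.2)
  obtain ⟨hax, hax0⟩ := lt_min_iff.1 ham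
  obtain ⟨hbx, hbx0⟩ := max_lt_iff.1 hbm
  have hsub : Icc a b ⊆ Ioo 0 R := fun y hy => ⟨ha.trans_le hy.1, hy.2.trans_lt hb⟩
  obtain ⟨M, hM⟩ := isCompact_Icc.exists_bound_of_continuousOn (hC.mono hsub)
  have hM0 : 0 ≤ M := (norm_nonneg _).trans (hM x ⟨hax.le, hbx.le⟩)
  -- The first-order system for the pair (u, r u'). On (a, b) its components have Lipschitz
  -- constants 1/a and M.
  set V : ℝ → ℝ × ℝ → ℝ × ℝ := fun t p => (p.2 / t, C t * p.1) with hV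
  set K : NNReal := Real.toNNReal (max a⁻¹ M) with hK
  have hKc : (K : ℝ) = max a⁻¹ M := Real.coe_toNNReal _ (le_max_of_le_right hM0)
  have hLip : ∀ t ∈ Ioo a b, LipschitzOnWith K (V t) univ := by
    intro t ht
    refine LipschitzWith.lipschitzOnWith (LipschitzWith.of_dist_le_mul fun p q => ?_)
    rw [hKc, Prod.dist_eq]
    have hp1 : dist p.1 q.1 ≤ dist p q := by rw [Prod.dist_eq]; exact le_max_left _ _
    have hp2 : dist p.2 q.2 ≤ dist p q := by rw [Prod.dist_eq]; exact le_max_right _ _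
    have ht0 : 0 < t := ha.trans ht.1
    refine max_le ?_ ?_
    · simp only [hV, Real.dist_eq]
      rw [← sub_div, abs_div, abs_of_pos ht0, div_eq_inv_mul]
      exact mul_le_mul ((inv_anti₀ ha ht.1.le).trans (le_max_left _ _)) hp2 (abs_nonneg _)
        (le_max_of_le_right hM0)
    · simp only [hV, Real.dist_eq]
      rw [← mul_sub, abs_mul]
      exact mul_le_mul ((hM t (Ioo_subset_Icc_self ht)).trans (le_max_right _ _)) hp1
        (abs_nonneg _) (le_max_of_le_right hM0)
  have key := ODE_solution_unique_of_mem_Ioo (v := V) (K := K) (s := fun _ => univ)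
    (f := fun t => (u t, t * deriv u t)) (g := fun _ => (0, 0)) (t₀ := x₀) hLip ⟨hax0, hbx0⟩
    (fun t ht => ⟨by
      have ht' := hsub (Ioo_subset_Icc_self ht)
      have ht0 : t ≠ 0 := ht'.1.ne'
      have := (h1 t ht').hasDerivAt.prodMk (h2 t ht')
      refine this.congr_deriv ?_
      simp only [hV]
      rw [mul_div_cancel_left₀ _ ht0], mem_univ _⟩)
    (fun t ht => ⟨by
      refine (hasDerivAt_const t ((0 : ℝ), (0 : ℝ))).congr_deriv ?_
      simp only [hV, zero_div, mul_zero]; rfl, mem_univ _⟩) (by simp [hz, hd])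
  exact congrArg Prod.fst (key ⟨hax, hbx⟩)

/-! ### Behaviour at the origin -/

/-- Otherwise u ≥ ε on (0, δ), and 1/r would be integrable at 0. -/
theorem exists_lt_of_integrableOn_inv {δ ε : ℝ} (hδ : 0 < δ) (hε : 0 < ε)
    (hi : IntegrableOn (fun r => r⁻¹ * u r ^ 2) (Ioo 0 δ)) : ∃ r ∈ Ioo 0 δ, u r < ε := by
  by_contra hcon
  push Not at hcon
  have h1 : IntegrableOn (fun r : ℝ => r⁻¹) (Ioo 0 δ) := by
    refine (hi.const_mul (ε ^ 2)⁻¹).mono' measurable_inv.aestronglyMeasurable ?_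
    filter_upwards [ae_restrict_mem measurableSet_Ioo] with r hr
    have h0 := inv_pos.2 hr.1
    rw [Real.norm_eq_abs, abs_of_pos h0, inv_mul_eq_div, le_div_iff₀ (by positivity)]
    exact mul_le_mul_of_nonneg_left (pow_le_pow_left₀ hε.le (hcon r hr) 2) h0.le
  have h2 := (intervalIntegrable_iff_integrableOn_Ioo_of_le hδ.le).2 h1
  rw [intervalIntegrable_inv_iff] at h2
  rcases h2 with h | h
  · exact hδ.ne h
  · exact h (by simp [hδ.le])

/-- Where C ≥ 0, r u' is nondecreasing. This makes u monotone near 0, and integrability of u²/r then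
forces its limit at 0 to be 0. -/
theorem absolutelyContinuousOnInterval_zero {C : ℝ → ℝ} {δ : ℝ} (hδ : 0 < δ) (hδR : δ < R)
    (hu : FiniteEnergy R u) (hu0 : u 0 = 0) (hCpos : ∀ x ∈ Ioo 0 δ, 0 ≤ C x)
    (h1 : ∀ x ∈ Ioo 0 R, DifferentiableAt ℝ u x)
    (h2 : ∀ x ∈ Ioo 0 R, HasDerivAt (fun s => s * deriv u s) (C x * u x) x)
    (hpos : ∀ x ∈ Ioo 0 R, 0 < u x) : AbsolutelyContinuousOnInterval u 0 R := by
  have hR : 0 < R := hδ.trans hδR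
  have hsub : Ioo 0 δ ⊆ Ioo 0 R := Ioo_subset_Ioo_right hδR.le
  have hmono : MonotoneOn (fun s => s * deriv u s) (Ioo 0 δ) := by
    refine monotoneOn_of_deriv_nonneg (convex_Ioo 0 δ)
      (fun x hx => (h2 x (hsub hx)).continuousAt.continuousWithinAt) ?_ ?_
    · rw [interior_Ioo]
      exact fun x hx => (h2 x (hsub hx)).differentiableAt.differentiableWithinAt
    · rw [interior_Ioo]
      intro x hx
      rw [(h2 x (hsub hx)).deriv]
      exact mul_nonneg (hCpos x hx) (hpos x (hsub hx)).le
  -- If u'(x) < 0, then r u' < 0 on (0, x), so u ≥ u(x) > 0 down to the origin, against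
  -- `exists_lt_of_integrableOn_inv`.
  have hdnn : ∀ x ∈ Ioo 0 δ, 0 ≤ deriv u x := by
    intro x hx
    by_contra hneg
    push Not at hneg
    have hxR := hsub hx
    have hanti : AntitoneOn u (Ioc 0 x) := by
      refine antitoneOn_of_deriv_nonpos (convex_Ioc 0 x)
        (hu.continuousOn.mono (Ioc_subset_Ioc_right hxR.2.le)) ?_ ?_
      · rw [interior_Ioc]
        exact fun y hy => (h1 y ⟨hy.1, hy.2.trans hxR.2⟩).differentiableWithinAt
      · rw [interior_Ioc]
        intro y hy
        have h3 := hmono ⟨hy.1, hy.2.trans hx.2⟩ hx hy.2.le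
        simp only at h3
        by_contra h4
        push Not at h4
        nlinarith [mul_pos hy.1 h4, mul_pos hx.1 (neg_pos.2 hneg)]
    obtain ⟨r, hr, hlt⟩ := exists_lt_of_integrableOn_inv hx.1 (hpos x hxR)
      (hu.integrableOn_inv.mono_set (Ioo_subset_Ioo_right hxR.2.le))
    exact absurd (hanti ⟨hr.1, hr.2.le⟩ ⟨hx.1, le_rfl⟩ hr.2.le) (not_le.2 hlt)
  have humono : MonotoneOn u (Ioo 0 δ) := by
    refine monotoneOn_of_deriv_nonneg (convex_Ioo 0 δ)
      (fun x hx => (h1 x (hsub hx)).continuousAt.continuousWithinAt) ?_ ?_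
    · rw [interior_Ioo]
      exact fun x hx => (h1 x (hsub hx)).differentiableWithinAt
    · rw [interior_Ioo]; exact hdnn
  have hcont : ContinuousOn u (Icc 0 R) := by
    intro x hx
    rcases hx.1.eq_or_lt with h | h
    · subst h
      rw [Metric.continuousWithinAt_iff]
      intro ε hε
      obtain ⟨r, hr, hlt⟩ := exists_lt_of_integrableOn_inv hδ hε
        (hu.integrableOn_inv.mono_set hsub)
      refine ⟨r, hr.1, fun y hy hyr => ?_⟩
      rw [Real.dist_eq, sub_zero, abs_of_nonneg hy.1] at hyr
      rw [hu0, Real.dist_eq, sub_zero]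
      rcases hy.1.eq_or_lt with h | h
      · rw [← h, hu0]; simpa using hε
      · have hyδ : y ∈ Ioo 0 δ := ⟨h, hyr.trans hr.2⟩
        rw [abs_of_pos (hpos y (hsub hyδ))]
        exact (humono hyδ hr hyr.le).trans_lt hlt
    · have hc := hu.continuousOn x ⟨h, hx.2⟩
      refine hc.mono_of_mem_nhdsWithin ?_
      filter_upwards [mem_nhdsWithin_of_mem_nhds (Ioi_mem_nhds h), self_mem_nhdsWithin] with y hy hy'
      exact ⟨hy, hy'.2⟩
  refine absolutelyContinuousOnInterval_of_deriv hR.le hcont h1 ?_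
  have hd2 : 0 < δ / 2 := by linarith
  -- A nonnegative derivative of a function continuous up to the endpoint is integrable.
  have hi1 : IntervalIntegrable (deriv u) volume 0 (δ / 2) := by
    rw [intervalIntegrable_iff_integrableOn_Ioc_of_le hd2.le]
    refine intervalIntegral.integrableOn_deriv_of_nonneg
      (hcont.mono (Icc_subset_Icc_right (by linarith)))
      (fun x hx => (h1 x ⟨hx.1, by linarith [hx.2]⟩).hasDerivAt)
      fun x hx => hdnn x ⟨hx.1, by linarith [hx.2]⟩
  exact hi1.trans (hu.intervalIntegrable_deriv hd2 (by linarith) le_rfl)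

/-! ### The Euler-Lagrange equation of positive minimisers -/

/-- The coefficient `C` of the Euler-Lagrange equation, written as `(r u')' = C u`. -/
def eulerLagrangeCoeff (n : ℤ) (α μ : ℝ) (u : ℝ → ℝ) (r : ℝ) : ℝ :=
  (n : ℝ) ^ 2 * r⁻¹ + 2 * α⁻¹ * r / (1 + α * u r ^ 2) + μ * r

theorem continuousOn_eulerLagrangeCoeff (hα : 0 < α) (μ : ℝ) (hu : FiniteEnergy R u) :
    ContinuousOn (eulerLagrangeCoeff n α μ u) (Ioo 0 R) := by
  have hc := hu.continuousOn.mono Ioo_subset_Ioc_self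
  refine ((continuousOn_const.mul (continuousOn_id.inv₀ fun r hr => hr.1.ne')).add
    ((continuousOn_const.mul continuousOn_id).div
      (continuousOn_const.add (continuousOn_const.mul (hc.pow 2))) fun r _ => ?_)).add
    (continuousOn_const.mul continuousOn_id)
  exact (lt_of_lt_of_le one_pos (one_le_one_add_mul_sq hα (u r))).ne'

theorem weak_form_eq (hα : 0 < α) (μ : ℝ) (hu : FiniteEnergy R u) (hv : FiniteEnergy R v) :
    kinForm n R u v + (α⁻¹) ^ 2 * logForm α R u v + μ * massForm R u v
      = (∫ r in Ioo 0 R, r * (deriv u r * deriv v r))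
        + ∫ r in Ioo 0 R, eulerLagrangeCoeff n α μ u r * u r * v r := by
  have h1 : kinForm n R u v = (∫ r in Ioo 0 R, r * (deriv u r * deriv v r))
      + (n : ℝ) ^ 2 * ∫ r in Ioo 0 R, r⁻¹ * (u r * v r) := by
    rw [kinForm, integral_add (hu.integrableOn_deriv_mul hv)
      ((hu.integrableOn_inv_mul hv).const_mul _), integral_const_mul]
  have h2 := integral_linear_combination (hu.integrableOn_inv_mul hv)
    (hu.integrableOn_logForm hα hv) (hu.integrableOn_mul hv) ((n : ℝ) ^ 2) ((α⁻¹) ^ 2) μ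
  rw [h1, logForm, massForm]
  have h3 : ∫ r in Ioo 0 R, eulerLagrangeCoeff n α μ u r * u r * v r
      = ∫ r in Ioo 0 R, ((n : ℝ) ^ 2 * (r⁻¹ * (u r * v r))
        + (α⁻¹) ^ 2 * (r * (2 * α * (u r * v r) / (1 + α * u r ^ 2)))
        + μ * (r * (u r * v r))) := by
    congr 1; ext r
    have h4 : 1 + α * u r ^ 2 ≠ 0 := by
      have := one_le_one_add_mul_sq hα (u r); linarith
    rw [eulerLagrangeCoeff]
    have e : (α⁻¹) ^ 2 * (r * (2 * α * (u r * v r) / (1 + α * u r ^ 2)))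
        = 2 * α⁻¹ * r / (1 + α * u r ^ 2) * (u r * v r) := by
      field_simp
    rw [e]; ring
  rw [h3, h2]; ring

/-- For such r one has |μ| r ≤ 1/r ≤ n²/r. -/
theorem eulerLagrangeCoeff_nonneg (hn : 1 ≤ |n|) (hα : 0 < α) (μ : ℝ) (u : ℝ → ℝ) {r : ℝ}
    (hr0 : 0 < r) (hr : r < 1 / (1 + |μ|)) : 0 ≤ eulerLagrangeCoeff n α μ u r := by
  have h1 : (1 : ℝ) ≤ (n : ℝ) ^ 2 := by
    have : (1 : ℤ) ≤ n ^ 2 := by nlinarith [sq_abs n]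
    exact_mod_cast this
  have h2 := one_le_one_add_mul_sq hα (u r)
  have h3 : 0 ≤ 2 * α⁻¹ * r / (1 + α * u r ^ 2) := by positivity
  have hμ := abs_nonneg μ
  rw [lt_div_iff₀ (by linarith)] at hr
  have h4 : |μ| * r ≤ r⁻¹ := by
    rw [inv_eq_one_div, le_div_iff₀ hr0]
    nlinarith [mul_nonneg hμ hr0.le]
  have h5 : -(|μ| * r) ≤ μ * r := by nlinarith [neg_abs_le μ]
  have h6 : r⁻¹ ≤ (n : ℝ) ^ 2 * r⁻¹ := le_mul_of_one_le_left (inv_pos.2 hr0).le h1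
  rw [eulerLagrangeCoeff]
  linarith

/-- The identity u²/(1 + αu²) = α⁻¹ - α⁻¹/(1 + αu²) turns the coefficient into the vortex
nonlinearity; the split-off α⁻¹ accounts for the shift in κ. -/
theorem isVortexSolution_of_hasDerivAt (hα : 0 < α) (μ : ℝ) (hu : ContinuousOn u (Icc 0 R))
    (h0 : u 0 = 0) (hR : u R = 0) (hd : ContDiffOn ℝ 2 u (Ioo 0 R))
    (h2 : ∀ x ∈ Ioo 0 R,
      HasDerivAt (fun s => s * deriv u s) (eulerLagrangeCoeff n α μ u x * u x) x) :
    IsVortexSolution n α R (μ / 2 + α⁻¹) u where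
  continuousOn := hu
  contDiffOn := hd
  equation r hr := by
    have h4 : 1 + α * u r ^ 2 ≠ 0 := by
      have := one_le_one_add_mul_sq hα (u r); linarith
    have hr0 : r ≠ 0 := hr.1.ne'
    rw [(h2 r hr).deriv, eulerLagrangeCoeff]
    field_simp
    ring
  left_boundary := h0
  right_boundary := hR

theorem action_eq_of_flux_eq {Q₀ : ℝ} (hα : 0 < α) (hu : FiniteEnergy R u) (hQ : flux R u = Q₀) :
    action n α R u = reducedAction n α R u - α⁻¹ * (Q₀ / (2 * Real.pi)) := by
  have hπ := Real.pi_pos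
  rw [hu.action_eq n hα, ← hQ, flux_eq, mul_div_cancel_left₀ _ (by positivity)]

theorem isLagrangeMultiplier_of_weak (hα : 0 < α) (hR : 0 < R) {μ : ℝ} (hu : FiniteEnergy R u)
    (hμ : ∀ v, FiniteEnergy R v →
      kinForm n R u v + (α⁻¹) ^ 2 * logForm α R u v + μ * massForm R u v = 0) :
    IsLagrangeMultiplier n α R (μ / 2 + α⁻¹) u := by
  intro v hvA
  have hv := finiteEnergy_of_mem_admissible hα hR hvA
  have hπ := Real.pi_pos
  have h1 : HasDerivAt (fun t : ℝ => massForm R u u + 2 * t * massForm R u v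
      + t ^ 2 * massForm R v v) (2 * massForm R u v) 0 := by
    have h2 := (((hasDerivAt_id (0:ℝ)).const_mul 2).mul_const (massForm R u v)).const_add
      (massForm R u u)
    have h3 := ((hasDerivAt_id (0:ℝ)).pow 2).mul_const (massForm R v v)
    refine (h2.add h3).congr_deriv ?_
    simp
  have h4 := (hu.hasDerivAt_reducedAction n hα hv).add (h1.const_mul (μ / 2))
  have hfun : (fun t : ℝ => action n α R (fun r => u r + t * v r)
      + (μ / 2 + α⁻¹) / (2 * Real.pi) * flux R (fun r => u r + t * v r))
      = fun t : ℝ => reducedAction n α R (fun r => u r + t * v r)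
        + μ / 2 * (massForm R u u + 2 * t * massForm R u v + t ^ 2 * massForm R v v) := by
    funext t
    rw [(hu.add_mul hv t).action_eq n hα, flux_eq, hu.massForm_add_mul hv]
    field_simp
    ring
  rw [hfun]
  refine h4.congr_deriv ?_
  linarith [hμ v hv]

/-- The minimiser over `FiniteEnergy` turns out to be admissible, and admissible functions lie in
`FiniteEnergy`, so it is minimal in the smaller class as well. -/
theorem exists_positive_minimizer (hn : 1 ≤ |n|) (hα : 0 < α) (hR : 0 < R) {Q₀ : ℝ}
    (hQ₀ : 0 < Q₀) :
    ∃ (u : ℝ → ℝ) (κ : ℝ), IsConstrainedMinimizer n α R Q₀ u ∧ IsLagrangeMultiplier n α R κ u ∧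
      IsVortexSolution n α R κ u ∧ ∀ r ∈ Ioo 0 R, 0 < u r := by
  have hπ := Real.pi_pos
  have hn0 : n ≠ 0 := by rintro rfl; simp at hn
  have hq : 0 < Q₀ / (2 * Real.pi) := by positivity
  obtain ⟨U, hUmin, hUq, hU0⟩ := exists_isReducedMinimizer (α := α) hn0 hα hR hq
  obtain ⟨u, hu0, humin, huq, hunn⟩ : ∃ u : ℝ → ℝ, u 0 = 0 ∧ IsReducedMinimizer n α R u ∧
      massForm R u u = Q₀ / (2 * Real.pi) ∧ ∀ r, 0 ≤ u r :=
    ⟨fun r => |U r|, by simp [hU0], hUmin.abs, by rw [massForm_abs, hUq], fun r => abs_nonneg _⟩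
  have hu := humin.1
  obtain ⟨μ, hμ⟩ := humin.exists_multiplier hα (by rw [huq]; exact hq)
  have hC := continuousOn_eulerLagrangeCoeff (n := n) hα μ hu
  have hF : ContinuousOn (fun r => eulerLagrangeCoeff n α μ u r * u r) (Ioo 0 R) :=
    hC.mul (hu.continuousOn.mono Ioo_subset_Ioc_self)
  have hreg := fun x hx => hasDerivAt_of_weak (x := x) hF hu
    (fun v hv => by rw [← weak_form_eq hα μ hu hv]; exact hμ v hv) hx
  have h1 : ∀ x ∈ Ioo 0 R, DifferentiableAt ℝ u x := fun x hx => (hreg x hx).1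
  have h2 : ∀ x ∈ Ioo 0 R,
      HasDerivAt (fun s => s * deriv u s) (eulerLagrangeCoeff n α μ u x * u x) x :=
    fun x hx => (hreg x hx).2
  have hpos : ∀ x ∈ Ioo 0 R, 0 < u x := by
    intro x hx
    refine (hunn x).lt_of_ne fun hz => ?_
    have hall := eq_zero_of_touching hC h1 h2 (fun y _ => hunn y) hx hz.symm
    have : massForm R u u = 0 := by
      rw [massForm]
      exact setIntegral_eq_zero_of_forall_eq_zero fun r hr => by rw [hall r hr]; ring
    exact hq.ne' (huq ▸ this)
  have hμ0 := abs_nonneg μ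
  -- R/2 keeps the neighbourhood of 0 inside (0, R); the other bound makes the coefficient
  -- nonnegative there.
  have hδ : 0 < min (R / 2) (1 / (1 + |μ|)) := lt_min (by linarith) (by positivity)
  have hac : AbsolutelyContinuousOnInterval u 0 R :=
    absolutelyContinuousOnInterval_zero hδ ((min_le_left _ _).trans_lt (by linarith)) hu hu0
      (fun x hx => eulerLagrangeCoeff_nonneg hn hα μ u hx.1 (hx.2.trans_le (min_le_right _ _)))
      h1 h2 hpos
  have hcont : ContinuousOn u (Icc 0 R) := by
    simpa [uIcc_of_le hR.le] using hac.continuousOn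
  have huA : u ∈ admissible α R := ⟨hac, hu0, hu.right_boundary, hu.energy_lt_top hα⟩
  have huQ : flux R u = Q₀ := by rw [flux_eq, huq]; field_simp
  refine ⟨u, μ / 2 + α⁻¹, ⟨huA, huQ, fun v hvA hvQ => ?_⟩,
    isLagrangeMultiplier_of_weak hα hR hu hμ,
    isVortexSolution_of_hasDerivAt hα μ hcont hu0 hu.right_boundary
      (contDiffOn_two_of_hasDerivAt hF h1 h2) h2, hpos⟩
  have hv := finiteEnergy_of_mem_admissible hα hR hvA
  rw [action_eq_of_flux_eq hα hu huQ, action_eq_of_flux_eq hα hv hvQ]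
  refine sub_le_sub_right (humin.2 v hv ?_) _
  rw [huq, ← hvQ, flux_eq]
  field_simp

end

end VortexSoliton

theorem theorem3p1 (n : ℤ) (hn : 1 ≤ |n|) (α R Q₀ : ℝ) (hα : 0 < α) (hR : 0 < R) (hQ₀ : 0 < Q₀) :
    (∃ (u : ℝ → ℝ) (κ : ℝ),
      VortexSoliton.IsConstrainedMinimizer n α R Q₀ u ∧
      VortexSoliton.IsLagrangeMultiplier n α R κ u ∧
      VortexSoliton.IsVortexSolution n α R κ u ∧
      ∀ r ∈ Set.Ioo 0 R, 0 < u r) ∧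
    (∀ κ : ℝ, (∀ r ∈ Set.Icc 0 R, 0 < (n : ℝ) ^ 2 + 2 * r ^ 2 * κ) → Q₀ ≤ 1 / 4 →
      ¬ ∃ u : ℝ → ℝ,
        VortexSoliton.IsVortexSolution n α R κ u ∧
        VortexSoliton.energy α R u < ⊤ ∧
        VortexSoliton.flux R u = Q₀ ∧
        ∃ r ∈ Set.Icc 0 R, u r ≠ 0) := by
  refine ⟨VortexSoliton.exists_positive_minimizer hn hα hR hQ₀, fun κ hκ hQ => ?_⟩
  rintro ⟨u, hu, he, hf, r, hr, hne⟩
  exact hne (hu.eq_zero_of_flux_le hα hR hκ he (hf.le.trans hQ) r hr)
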